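/- Let $P$ be an orthogonal projector on $L^2(\mathbb{R}^2)$ with an exponentially localized kernel: there are a measurable kernel $P(\cdot,\cdot):\mathbb{R}^2\times\mathbb{R}^2\to\mathbb{C}$ of $P$ and finite constants $C_0,\gamma_0>0$ with $|P(x,x')|\le C_0e^{-\gamma_0|x-x'|}$ for almost all $x,x'$. Let $X$ be the position operator $Xf(x)=x_1f(x)$ with domain $\mathcal D(X)=\{f\in L^2:x_1f\in L^2\}$, and consider the operator $PXP$ on $\{f\in L^2: Pf\in\mathcal D(X)\}=(\mathcal D(X)\cap\operatorname{range}P)\oplus(\operatorname{range}P)^\perp$. Suppose that $PXP$ has uniform spectral gaps: there are constants $d>0$, $D<\infty$, a countable set $\mathcal J$ and sets $\sigma_j\subseteq\mathbb{R}$ ($j\in\mathcal J$) with $\sigma(PXP)=\bigcup_{j\in\mathcal J}\sigma_j$, $\operatorname{dist}(\sigma_j,\sigma_k)\ge d$ for $j\ne k$, and $\operatorname{diam}(\sigma_j)\le D$ for all $j$. Fix constants $K,K'$ independent of $j$, and for $j\in\mathcal J$ let $$P_j:=P\Big(\frac1{2\pi i}\int_{\mathcal C_j}(\lambda-PXP)^{-1}\,d\lambda\Big)P$$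 be the band projector of $\sigma_j$, where $\mathcal C_j$ is a piecewise $C^1$ closed contour in the resolvent set of $PXP$ that encloses $\sigma_j$ once counterclockwise and encloses no point of $\sigma_k$ for $k\neq j$, with $\sup_{\lambda\in\mathcal C_j}\|(\lambda-PXP)^{-1}\|\le Kd^{-1}$ and length $\ell(\mathcal C_j)\le K'(D+d)$. For $a\in\mathbb{R}^2$ and $\gamma\ge0$ let $B_{\gamma,a}$ be multiplication by $\exp\big(\gamma\sqrt{1+(x_1-a_1)^2+(x_2-a_2)^2}\big)$ and $P_{j,\gamma,a}:=B_{\gamma,a}P_jB_{\gamma,a}^{-1}$. Then there exist finite constants $C,C',\gamma>0$, independent of $j$ and of the choice of the contours $\mathcal C_j$ (with the given $K,K'$), such that for all $j\in\mathcal J$: 1. $P_j$ has an integral kernel with $|P_j(x,x')|\le Ce^{-\gamma|x-x'|}$ for almost all $x,x'\in\mathbb{R}^2$; 2. for every $\eta_j\in\sigma_j$, every $0\le\gamma'\le\gamma$ and every $a\in\mathbb{R}^2$, the operator $(X-\eta_j)P_{j,\gamma',a}$ is defined on all of $L^2(\mathbb{R}^2)$, the operator $P_{j,\gamma',a}(X-\eta_j)$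 is defined on the dense subspace $\mathcal D(X)$, and $$\|(X-\eta_j)P_{j,\gamma',a}\|\le C',\qquad \|P_{j,\gamma',a}(X-\eta_j)\|\le C'.$$ -/

import Mathlib

open MeasureTheory

namespace BandProjectors

noncomputable section

/-- The plane `ℝ²` with its Euclidean norm. -/
abbrev Plane : Type := EuclideanSpace ℝ (Fin 2)

/-- The Hilbert space `L²(ℝ²; ℂ)`. -/
abbrev L2 : Type := Lp ℂ 2 (volume : Measure Plane)

/-! ### Unbounded operators on `L²(ℝ²)` -/

/-- The maximal domain `{f ∈ L² : m f ∈ L²}` of multiplication by the real function `m`. -/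
def mulDomain (m : Plane → ℝ) : Submodule ℂ L2 where
  carrier := {f | MemLp (fun x => (m x : ℂ) * f x) 2 volume}
  add_mem' := by
    intro f g hf hg
    refine (MemLp.add hf hg).ae_eq ?_
    filter_upwards [Lp.coeFn_add f g] with x hx
    simp only [Pi.add_apply, hx]
    ring
  zero_mem' := by
    refine (MemLp.zero (ε := ℂ)).ae_eq ?_
    filter_upwards [Lp.coeFn_zero ℂ 2 (volume : Measure Plane)] with x hx
    rw [hx]
    simp
  smul_mem' := by
    intro c f hf
    refine (MemLp.const_smul hf c).ae_eq ?_
    filter_upwards [Lp.coeFn_smul c f] with x hx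
    simp only [Pi.smul_apply, hx, smul_eq_mul]
    ring

theorem mulDomain_memLp {m : Plane → ℝ} (f : mulDomain m) :
    MemLp (fun x => (m x : ℂ) * (f : L2) x) 2 (volume : Measure Plane) := f.2

/-- Multiplication by the real function `m`, as a linear map on its maximal domain. -/
def mulFun (m : Plane → ℝ) : mulDomain m →ₗ[ℂ] L2 where
  toFun f := (mulDomain_memLp f).toLp
  map_add' f g := by
    rw [← MemLp.toLp_add]
    refine MemLp.toLp_congr _ _ ?_
    filter_upwards [Lp.coeFn_add (f : L2) (g : L2)] with x hx
    rw [Submodule.coe_add, hx]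
    simp only [Pi.add_apply]
    ring
  map_smul' c f := by
    rw [RingHom.id_apply, ← MemLp.toLp_const_smul]
    refine MemLp.toLp_congr _ _ ?_
    filter_upwards [Lp.coeFn_smul c (f : L2)] with x hx
    rw [Submodule.coe_smul, hx]
    simp only [Pi.smul_apply, smul_eq_mul]
    ring

/-- Multiplication by the real function `m`, as an unbounded operator on its maximal domain
`{f ∈ L² : m f ∈ L²}`. -/
def mulOp (m : Plane → ℝ) : L2 →ₗ.[ℂ] L2 := ⟨mulDomain m, mulFun m⟩

/-- A bounded operator, seen as an everywhere defined unbounded operator. -/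
def ofBounded (A : L2 →L[ℂ] L2) : L2 →ₗ.[ℂ] L2 :=
  (A : L2 →ₗ[ℂ] L2).toPMap ⊤

/-- The natural domain `{f ∈ D(T) : T f ∈ D(S)}` of the composition `S T`. -/
def compDomain (S T : L2 →ₗ.[ℂ] L2) : Submodule ℂ L2 where
  carrier := {f | ∃ h : f ∈ T.domain, T ⟨f, h⟩ ∈ S.domain}
  add_mem' := by
    rintro f g ⟨hf, hf'⟩ ⟨hg, hg'⟩
    refine ⟨T.domain.add_mem hf hg, ?_⟩
    have h : T ⟨f + g, T.domain.add_mem hf hg⟩ = T ⟨f, hf⟩ + T ⟨g, hg⟩ :=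
      T.map_add ⟨f, hf⟩ ⟨g, hg⟩
    rw [h]
    exact S.domain.add_mem hf' hg'
  zero_mem' := by
    refine ⟨T.domain.zero_mem, ?_⟩
    have h : T ⟨0, T.domain.zero_mem⟩ = 0 := T.map_zero
    rw [h]
    exact S.domain.zero_mem
  smul_mem' := by
    rintro c f ⟨hf, hf'⟩
    refine ⟨T.domain.smul_mem c hf, ?_⟩
    have h : T ⟨c • f, T.domain.smul_mem c hf⟩ = c • T ⟨f, hf⟩ := T.map_smul c ⟨f, hf⟩
    rw [h]
    exact S.domain.smul_mem c hf'

theorem compDomain_le (S T : L2 →ₗ.[ℂ] L2) : compDomain S T ≤ T.domain := fun _ hf => hf.1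

/-- The composition `S T` on its natural domain `{f ∈ D(T) : T f ∈ D(S)}`. -/
def opComp (S T : L2 →ₗ.[ℂ] L2) : L2 →ₗ.[ℂ] L2 where
  domain := compDomain S T
  toFun := S.toFun ∘ₗ
    (T.toFun ∘ₗ Submodule.inclusion (compDomain_le S T)).codRestrict S.domain
      (fun f => f.2.2)

/-- `X - η`, where `X` is the position operator `(X f)(x) = x₁ f(x)`; its domain is
`D(X) = {f ∈ L² : x₁ f ∈ L²}` for every real `η`. -/
def positionSub (η : ℝ) : L2 →ₗ.[ℂ] L2 := mulOp (fun x => x 0 - η)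

/-- The position operator `(X f)(x) = x₁ f(x)`. -/
def position : L2 →ₗ.[ℂ] L2 := mulOp (fun x => x 0)

/-- The operator `P X P`, with domain `{f ∈ L² : P f ∈ D(X)}`; for an orthogonal projector `P`
this is `(D(X) ∩ range P) ⊕ (range P)ᗮ`. -/
def projectedPosition (P : L2 →L[ℂ] L2) : L2 →ₗ.[ℂ] L2 :=
  opComp (ofBounded P) (opComp position (ofBounded P))

/-- The weight `exp (γ √(1 + (x₁ - a₁)² + (x₂ - a₂)²))`. -/
def expWeight (γ : ℝ) (a x : Plane) : ℝ :=
  Real.exp (γ * Real.sqrt (1 + (x 0 - a 0) ^ 2 + (x 1 - a 1) ^ 2))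

/-- The exponentially tilted operator `B A B⁻¹`, where `B` is multiplication by `expWeight γ a`,
on its natural domain. -/
def tilt (γ : ℝ) (a : Plane) (A : L2 →L[ℂ] L2) : L2 →ₗ.[ℂ] L2 :=
  opComp (mulOp (expWeight γ a))
    (opComp (ofBounded A) (mulOp (fun x => (expWeight γ a x)⁻¹)))

/-! ### Integral kernels -/

/-- `A` is the integral operator with kernel `k`: for every `f ∈ L²` and almost every `x`,
`(A f)(x) = ∫ k(x, x') f(x') dx'`, the integral being absolutely convergent. -/
def IsIntegralKernel (k : Plane × Plane → ℂ) (A : L2 →L[ℂ] L2) : Prop :=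
  AEStronglyMeasurable k (volume : Measure (Plane × Plane)) ∧
    ∀ f : L2, ∀ᵐ x : Plane,
      Integrable (fun x' : Plane => k (x, x') * f x') ∧
        A f x = ∫ x' : Plane, k (x, x') * f x'

/-- `A` has an integral kernel bounded almost everywhere by `C exp (-γ |x - x'|)`. -/
def HasExpBoundedKernel (A : L2 →L[ℂ] L2) (C γ : ℝ) : Prop :=
  ∃ k : Plane × Plane → ℂ, IsIntegralKernel k A ∧
    ∀ᵐ p : Plane × Plane, ‖k p‖ ≤ C * Real.exp (-γ * ‖p.1 - p.2‖)

/-- `P` is an orthogonal projector with an exponentially localized kernel. -/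
def IsExpLocalizedProjector (P : L2 →L[ℂ] L2) : Prop :=
  IsStarProjection P ∧ ∃ C γ : ℝ, 0 < C ∧ 0 < γ ∧ HasExpBoundedKernel P C γ

/-! ### Spectrum and resolvent of an unbounded operator -/

/-- `R` is a bounded two-sided inverse of `z - T : D(T) → L²`. -/
def IsResolventAt (T : L2 →ₗ.[ℂ] L2) (z : ℂ) (R : L2 →L[ℂ] L2) : Prop :=
  (∀ f : L2, ∃ h : R f ∈ T.domain, z • R f - T ⟨R f, h⟩ = f) ∧
    ∀ f : T.domain, R (z • (f : L2) - T f) = f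

/-- The resolvent set of `T`. -/
def opResolventSet (T : L2 →ₗ.[ℂ] L2) : Set ℂ := {z | ∃ R, IsResolventAt T z R}

/-- The spectrum of `T`. -/
def opSpectrum (T : L2 →ₗ.[ℂ] L2) : Set ℂ := (opResolventSet T)ᶜ

open Classical in
/-- The resolvent `(z - T)⁻¹` for `z` in the resolvent set (and `0` otherwise). -/
def opResolvent (T : L2 →ₗ.[ℂ] L2) (z : ℂ) : L2 →L[ℂ] L2 :=
  if h : ∃ R, IsResolventAt T z R then h.choose else 0

/-- `T` has uniform spectral gaps with constants `(d, D)` and decomposition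
`σ(T) = ⋃ⱼ σⱼ`: `dist(σⱼ, σₖ) ≥ d > 0` for `j ≠ k` and `diam σⱼ ≤ D` for all `j`. -/
structure UniformSpectralGaps {J : Type*} (T : L2 →ₗ.[ℂ] L2) (σ : J → Set ℝ) (d D : ℝ) :
    Prop where
  gap_pos : 0 < d
  spectrum_eq : opSpectrum T = ⋃ j, (fun t : ℝ => (t : ℂ)) '' σ j
  le_dist : ∀ j k, j ≠ k → ∀ s ∈ σ j, ∀ t ∈ σ k, d ≤ |s - t|
  diam_le : ∀ j, ∀ s ∈ σ j, ∀ t ∈ σ j, |s - t| ≤ D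

/-! ### Contours and band projectors -/

/-- `c : [0, 1] → ℂ` is a piecewise continuously differentiable closed curve. -/
structure IsClosedContour (c : ℝ → ℂ) : Prop where
  continuousOn : ContinuousOn c (Set.Icc 0 1)
  closed : c 0 = c 1
  piecewise : ∃ s : Finset ℝ, (∀ t ∈ Set.Ioo (0 : ℝ) 1, t ∉ s → DifferentiableAt ℝ c t) ∧
    ContinuousOn (deriv c) (Set.Ioo 0 1 \ s)
  integrable : IntervalIntegrable (deriv c) volume 0 1

/-- The length of a curve. -/
def contourLength (c : ℝ → ℂ) : ℝ := ∫ t in (0 : ℝ)..1, ‖deriv c t‖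

/-- The winding number of a closed contour around a point `z` off the contour. -/
def windingNumber (c : ℝ → ℂ) (z : ℂ) : ℂ :=
  (2 * Real.pi * Complex.I)⁻¹ * ∫ t in (0 : ℝ)..1, deriv c t / (c t - z)

/-- `c` is an admissible contour for the `j`-th band of `T`: it lies in the resolvent set, it
encloses `σⱼ` (once, counterclockwise) and no other part of the spectrum, and
`‖(z - T)⁻¹‖ ≤ K d⁻¹` on the contour, whose length is at most `K' (D + d)`. -/
structure IsBandContour {J : Type*} (T : L2 →ₗ.[ℂ] L2) (σ : J → Set ℝ) (d D K K' : ℝ) (j : J)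
    (c : ℝ → ℂ) : Prop where
  contour : IsClosedContour c
  mem_resolventSet : ∀ t ∈ Set.Icc (0 : ℝ) 1, c t ∈ opResolventSet T
  winding_self : ∀ s ∈ σ j, windingNumber c (s : ℂ) = 1
  winding_other : ∀ k, k ≠ j → ∀ s ∈ σ k, windingNumber c (s : ℂ) = 0
  norm_resolvent_le : ∀ t ∈ Set.Icc (0 : ℝ) 1, ‖opResolvent T (c t)‖ ≤ K * d⁻¹
  length_le : contourLength c ≤ K' * (D + d)

/-- The Riesz integral `(2πi)⁻¹ ∫_c (z - T)⁻¹ dz`. -/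
def rieszIntegral (T : L2 →ₗ.[ℂ] L2) (c : ℝ → ℂ) : L2 →L[ℂ] L2 :=
  (2 * Real.pi * Complex.I : ℂ)⁻¹ • ∫ t in (0 : ℝ)..1, deriv c t • opResolvent T (c t)

/-- `Pj` is the band projector `P ((2πi)⁻¹ ∫_c (z - PXP)⁻¹ dz) P` of the `j`-th band of `PXP`,
for an admissible contour `c`. -/
def IsBandProjector {J : Type*} (P : L2 →L[ℂ] L2) (σ : J → Set ℝ) (d D K K' : ℝ) (j : J)
    (Pj : L2 →L[ℂ] L2) : Prop :=
  ∃ c : ℝ → ℂ, IsBandContour (projectedPosition P) σ d D K K' j c ∧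
    Pj = P ∘L rieszIntegral (projectedPosition P) c ∘L P

/-! ### Norm bounds -/

/-- `A` is defined on all of `L²` and `‖A‖ ≤ C`. -/
def IsBoundedBy (A : L2 →ₗ.[ℂ] L2) (C : ℝ) : Prop :=
  A.domain = ⊤ ∧ ∀ f : A.domain, ‖A f‖ ≤ C * ‖(f : L2)‖

/-- `A` is defined (at least) on `D(X)`, which is dense, and `‖A f‖ ≤ C ‖f‖` on its domain,
so that `A` extends uniquely to a bounded operator of norm at most `C`. -/
def IsBoundedOnPositionDomainBy (A : L2 →ₗ.[ℂ] L2) (C : ℝ) : Prop :=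
  position.domain ≤ A.domain ∧ ∀ f : A.domain, ‖A f‖ ≤ C * ‖(f : L2)‖

end

end BandProjectors

open BandProjectors

/-! A band projector is `P_j = (2πi)⁻¹ ∫ r_z dz` over its contour, where `r_z = (z - PXP)⁻¹ P` is
the compressed resolvent: `u = r_z f` is the only `u ∈ range P ∩ D(X)` with `z u - P X u = P f`.
Everything follows from uniform bounds on the tilts `B r_z B⁻¹`.

The kernels of the tilt `P' = B P B⁻¹`, of the commutator `A' = [X, P']` and of `P' - P` are
`w(x) k(x, y) / w(y)`, `(x₁ - y₁) w(x) k(x, y) / w(y)` and `(w(x) / w(y) - 1) k(x, y)`, for `w` the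
weight. They decay exponentially because `log w` is Lipschitz, so Schur's test bounds the operators
uniformly in the centre of the weight, and `‖P' - P‖ = O(γ)` (`IsExpKernel.exists_tilt`).

The difference `P'XP' - PXP` is unbounded, so the tilted resolvent is not reached by perturbing
`PXP` directly. Instead `P' r_z P'` is a right parametrix of `z - P'XP'` on `range P'`: with
`A = [X, P]`, the vanishing of `P A P` and `P' A' P'` shows that
`(z - P'XP') P' r_z P' = P' - F`, where every term of `F` is a product of
`P' - P` with bounded operators among `P'`, `A`, `A'` and `r_z`. For small `γ` a Neumann series yields the compressed resolvent `s_z` of `P'XP'`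
with a bound independent of `z`, and uniqueness identifies it with `B r_z B⁻¹`
(`IsCompressedResolvent.exists_tilt`). The identities `X s_z = z s_z + A' s_z - P'` and
`s_z X = z s_z - P' - s_z A'` then bound `(X - η) s_z` and `s_z (X - η)` by `|z - η|`, which is at
most twice the length of the contour if the contour winds around `η`. Integrating over the contour
(`exists_tilt_contourIntegral`) gives the norm bounds on the tilted band projectors.

For the kernel, `P_j = P P_j P` has the kernel `⟪row x, P_j (row y)⟫`, where `row x = conj k(x, ·)`.
With the weight centred at `y`, this is `⟪B⁻¹ row x, (B P_j B⁻¹) B row y⟫`, and `B⁻¹ row x` has norm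
`O(exp (-γ |x - y|))` (`IsExpKernel.hasExpBoundedKernel`). -/

open MeasureTheory BandProjectors

open scoped ENNReal ComplexConjugate InnerProductSpace

namespace BandProjectors

/-! ### Compressed resolvents and their perturbation -/

section Compressed

variable {H : Type*} [NormedAddCommGroup H] [NormedSpace ℂ H]

/-- For an unbounded operator `X` with graph `G` and an idempotent `P`, the bounded operator `r` is
the compressed resolvent `(z - PXP)⁻¹ P` at `z`: the vector `r f` is the only `u ∈ range P ∩ D(X)`
with `z u - P X u = P f`. -/
structure IsCompressedResolvent (G : Submodule ℂ (H × H)) (P : H →L[ℂ] H) (z : ℂ)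
    (r : H →L[ℂ] H) : Prop where
  exists_graph : ∀ f, ∃ g, (r f, g) ∈ G ∧ z • r f - P g = P f
  range : ∀ f, P (r f) = r f
  unique : ∀ u g f, (u, g) ∈ G → P u = u → z • u - P g = P f → u = r f

/-- `A` is the commutator `[X, P]` of the operator `X` with graph `G` and the bounded operator `P`;
in particular `P` preserves `D(X)`. -/
def IsCommutator (G : Submodule ℂ (H × H)) (P A : H →L[ℂ] H) : Prop :=
  ∀ f g, (f, g) ∈ G → (P f, P g + A f) ∈ G

variable {G : Submodule ℂ (H × H)} {P A r s : H →L[ℂ] H} {z w : ℂ}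

namespace IsCompressedResolvent

/-- `X r = z r + [X, P] r - P`. -/
theorem graph_mem (h : IsCompressedResolvent G P z r) (hA : IsCommutator G P A) (f : H) :
    (r f, z • r f + A (r f) - P f) ∈ G := by
  obtain ⟨g, hg, hz⟩ := h.exists_graph f
  have := hA _ _ hg
  rw [h.range] at this
  convert this using 2
  rw [← hz]
  abel

/-- `r X = z r - P - r [X, P]` on `D(X)`. -/
theorem apply_of_mem (h : IsCompressedResolvent G P z r) (hP : ∀ f, P (P f) = P f)
    (hA : IsCommutator G P A) {f g : H} (hfg : (f, g) ∈ G) :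
    r g = z • r f - P f - r (A f) := by
  have := h.unique (P f) (P g + A f) (z • f - g - A f) (hA _ _ hfg) (hP f) (by
    simp only [map_sub, map_add, map_smul, hP]
    abel)
  rw [this]
  simp only [map_sub, map_smul]
  abel

/-- The first resolvent identity. -/
theorem resolvent_identity (h : IsCompressedResolvent G P z r)
    (h' : IsCompressedResolvent G P w s) (f : H) :
    s f - r f = (z - w) • r (s f) := by
  obtain ⟨g, hg, hw⟩ := h'.exists_graph f
  have := h.unique (s f) g (f + (z - w) • s f) hg (h'.range f) (by
    rw [map_add, ← hw, map_smul, h'.range, sub_smul]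
    abel)
  rw [sub_eq_iff_eq_add, add_comm, ← map_smul, ← map_add]
  exact this

theorem norm_sub_le_sq_mul (h : IsCompressedResolvent G P z r) (h' : IsCompressedResolvent G P w s)
    {M : ℝ} (hr : ‖r‖ ≤ M) (hs : ‖s‖ ≤ M) : ‖s - r‖ ≤ M ^ 2 * ‖w - z‖ := by
  have hM : 0 ≤ M := (norm_nonneg _).trans hr
  refine ContinuousLinearMap.opNorm_le_bound _ (by positivity) fun f => ?_
  rw [sub_apply, h.resolvent_identity h', norm_smul, norm_sub_rev z w]
  calc ‖w - z‖ * ‖r (s f)‖ ≤ ‖w - z‖ * (M * (M * ‖f‖)) := by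
        gcongr
        exact (r.le_of_opNorm_le hr _).trans (by gcongr; exact s.le_of_opNorm_le hs _)
    _ = M ^ 2 * ‖w - z‖ * ‖f‖ := by ring

end IsCompressedResolvent

/-- `P [X, P] P = 0`, on vectors of `range P ∩ D(X)`. -/
theorem IsCommutator.apply_eq_zero (hA : IsCommutator G P A) (hP : ∀ f, P (P f) = P f)
    (hG : ∀ f g g', (f, g) ∈ G → (f, g') ∈ G → g = g') {u g : H} (hu : (u, g) ∈ G)
    (hPu : P u = u) : P (A u) = 0 := by
  have h1 := hA _ _ hu
  rw [hPu] at h1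
  have h2 := hA _ _ h1
  rw [hPu] at h2
  have h3 := hG _ _ _ h1 h2
  rw [map_add, hP, add_left_inj] at h3
  simpa using h3

theorem exists_inverse_one_sub [CompleteSpace H] {F : H →L[ℂ] H} (hF : ‖F‖ ≤ 1 / 2) :
    ∃ N : H →L[ℂ] H, (∀ f, N f - F (N f) = f) ∧ ‖N‖ ≤ 2 := by
  obtain ⟨u, hu⟩ := isUnit_one_sub_of_norm_lt_one (x := F) (by linarith)
  have key : ∀ f, (↑u⁻¹ : H →L[ℂ] H) f - F ((↑u⁻¹ : H →L[ℂ] H) f) = f := fun f => by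
    have := u.mul_inv
    rw [hu] at this
    simpa using congrArg (fun T : H →L[ℂ] H => T f) this
  refine ⟨↑u⁻¹, key, ContinuousLinearMap.opNorm_le_bound _ (by norm_num) fun f => ?_⟩
  set n := (↑u⁻¹ : H →L[ℂ] H) f
  have h1 : ‖n‖ ≤ ‖f‖ + ‖F n‖ := by
    have h := norm_add_le f (F n)
    rwa [show f + F n = n by nth_rewrite 1 [← key f]; abel] at h
  have h2 := F.le_of_opNorm_le hF n
  linarith

/-- Stability of compressed resolvents under similarity. Let `P' = W⁻¹ P W` with `W` preserving
`D(X)` and commuting with `X`. If `P' - P` is small, the similar operator `W⁻¹ r W` is bounded, and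
it is the compressed resolvent of `P' X P'`. -/
theorem IsCompressedResolvent.exists_tilt [CompleteSpace H] {P' A' W : H →L[ℂ] H}
    (h : IsCompressedResolvent G P z r)
    (hG : ∀ f g g', (f, g) ∈ G → (f, g') ∈ G → g = g')
    (hP : ∀ f, P (P f) = P f) (hA : IsCommutator G P A) (hA' : IsCommutator G P' A')
    (hW : Function.Injective W) (hWG : ∀ f g, (f, g) ∈ G → (W f, W g) ∈ G)
    (hPW : ∀ f, P (W f) = W (P' f)) {M p α : ℝ} (hp : 1 ≤ p)
    (hr : ‖r‖ ≤ M) (hp' : ‖P'‖ ≤ p) (hα : ‖A‖ ≤ α) (hα' : ‖A'‖ ≤ α)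
    (hsmall : ‖P' - P‖ * (p ^ 2 * (1 + 2 * α * M)) ≤ 1 / 2) :
    ∃ s, IsCompressedResolvent G P' z s ∧ (∀ f, W (s f) = r (W f)) ∧ ‖s‖ ≤ 2 * p ^ 2 * M := by
  have hM : 0 ≤ M := (norm_nonneg _).trans hr
  have hα0 : 0 ≤ α := (norm_nonneg _).trans hα
  have hP' : ∀ f, P' (P' f) = P' f := fun f => hW (by rw [← hPW, ← hPW, hP, hPW])
  -- `z - P'XP'` maps `P' r P' f` to `P' f - F f`
  set F : H →L[ℂ] H := P' - P' ∘L (P - A ∘L r - A' ∘L r) ∘L P' with hFdef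
  have hFP : ∀ f, P' (F f) = F f := fun f => by simp [hFdef, hP']
  -- the diagonal blocks of the commutators vanish
  have hPAr : ∀ f, P (A (r f)) = 0 := fun f => by
    obtain ⟨g, hg, -⟩ := h.exists_graph f
    exact hA.apply_eq_zero hP hG hg (h.range f)
  have hPAr' : ∀ f, P' (A' (P' (r f))) = 0 := fun f => by
    obtain ⟨g, hg, -⟩ := h.exists_graph f
    exact hA'.apply_eq_zero hP' hG (hA' _ _ hg) (hP' _)
  have hF : F = P' ∘L (P' - P) ∘L P' + (P' - P) ∘L A ∘L r ∘L P'
      - P' ∘L A' ∘L (P' - P) ∘L r ∘L P' := by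
    ext f
    simp only [hFdef, sub_apply, add_apply,
      ContinuousLinearMap.comp_apply, map_sub, hP', hPAr, hPAr', h.range]
    abel
  have hFn : ‖F‖ ≤ 1 / 2 := by
    refine le_trans ?_ hsmall
    set e := ‖P' - P‖
    have he : 0 ≤ e := norm_nonneg _
    have hp0 : 0 ≤ p := by linarith
    have b1 : ‖P' ∘L (P' - P) ∘L P'‖ ≤ p * (e * p) := by
      refine (ContinuousLinearMap.opNorm_comp_le _ _).trans ?_
      gcongr
      refine (ContinuousLinearMap.opNorm_comp_le _ _).trans ?_
      gcongr
    have b2 : ‖(P' - P) ∘L A ∘L r ∘L P'‖ ≤ e * (α * (M * p)) := by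
      refine (ContinuousLinearMap.opNorm_comp_le _ _).trans ?_
      gcongr
      refine (ContinuousLinearMap.opNorm_comp_le _ _).trans ?_
      gcongr
      refine (ContinuousLinearMap.opNorm_comp_le _ _).trans ?_
      gcongr
    have b3 : ‖P' ∘L A' ∘L (P' - P) ∘L r ∘L P'‖ ≤ p * (α * (e * (M * p))) := by
      refine (ContinuousLinearMap.opNorm_comp_le _ _).trans ?_
      gcongr
      refine (ContinuousLinearMap.opNorm_comp_le _ _).trans ?_
      gcongr
      refine (ContinuousLinearMap.opNorm_comp_le _ _).trans ?_
      gcongr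
      refine (ContinuousLinearMap.opNorm_comp_le _ _).trans ?_
      gcongr
    have b4 : e * (α * (M * p)) ≤ e * (α * (M * (p * p))) := by
      gcongr
      nlinarith
    rw [hF]
    calc _ ≤ p * (e * p) + e * (α * (M * (p * p))) + p * (α * (e * (M * p))) :=
          norm_sub_le_of_le (norm_add_le_of_le b1 (b2.trans b4)) b3
      _ = e * (p ^ 2 * (1 + 2 * α * M)) := by ring
  obtain ⟨N, hN, hN2⟩ := exists_inverse_one_sub hFn
  set s : H →L[ℂ] H := P' ∘L r ∘L P' ∘L N
  have hs : ∀ f, ∃ g, (s f, g) ∈ G ∧ z • s f - P' g = P' f := fun f => by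
    refine ⟨_, hA' _ _ (h.graph_mem hA (P' (N f))), ?_⟩
    have h1 : P' (N f) - F (N f) = P' f := by
      conv_rhs => rw [← hN f]
      rw [map_sub, hFP]
    rw [← h1]
    simp only [s, hFdef, sub_apply, ContinuousLinearMap.comp_apply, map_sub,
      map_add, map_smul, hP']
    abel
  have hsP : ∀ f, P' (s f) = s f := fun f => hP' _
  have hWs : ∀ f, W (s f) = r (W f) := fun f => by
    obtain ⟨g, hg, hz⟩ := hs f
    refine h.unique _ _ _ (hWG _ _ hg) ?_ ?_
    · rw [hPW, hsP]
    · rw [hPW, hPW, ← hz, map_sub, map_smul]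
  refine ⟨s, ⟨hs, hsP, fun u g f hu hPu hz => hW ?_⟩, hWs, ?_⟩
  · rw [hWs]
    refine h.unique _ _ _ (hWG _ _ hu) ?_ ?_
    · rw [hPW, hPu]
    · rw [hPW, hPW, ← hz, map_sub, map_smul]
  · calc ‖s‖ ≤ p * (M * (p * 2)) := by
          refine (ContinuousLinearMap.opNorm_comp_le _ _).trans ?_
          gcongr
          refine (ContinuousLinearMap.opNorm_comp_le _ _).trans ?_
          gcongr
          refine (ContinuousLinearMap.opNorm_comp_le _ _).trans ?_
          gcongr
      _ = 2 * p ^ 2 * M := by ring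

end Compressed

/-! ### Graphs of unbounded operators on `L²(ℝ²)` -/

theorem mem_mulOp_graph_iff {m : Plane → ℝ} {f g : L2} :
    (f, g) ∈ (mulOp m).graph ↔ (g : Plane → ℂ) =ᵐ[volume] fun x => (m x : ℂ) * f x := by
  rw [LinearPMap.mem_graph_iff]
  constructor
  · rintro ⟨y, hy, rfl⟩
    simp only at hy
    rw [← hy]
    exact MemLp.coeFn_toLp (mulDomain_memLp y)
  · intro h
    have hf : f ∈ mulDomain m := (Lp.memLp g).ae_eq h
    refine ⟨⟨f, hf⟩, rfl, ?_⟩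
    exact Lp.ext ((MemLp.coeFn_toLp (mulDomain_memLp ⟨f, hf⟩)).trans h.symm)

theorem mem_position_graph_iff {f g : L2} :
    (f, g) ∈ position.graph ↔ (g : Plane → ℂ) =ᵐ[volume] fun x => (x 0 : ℂ) * f x :=
  mem_mulOp_graph_iff

theorem mem_positionSub_graph_iff {η : ℝ} {f g : L2} :
    (f, g) ∈ (positionSub η).graph ↔ (f, g + (η : ℂ) • f) ∈ position.graph := by
  rw [mem_position_graph_iff, positionSub, mem_mulOp_graph_iff]
  have h := (Lp.coeFn_add g ((η : ℂ) • f)).and (Lp.coeFn_smul (η : ℂ) f)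
  constructor <;> intro h'
  · filter_upwards [h, h'] with x h1 h2
    rw [h1.1, Pi.add_apply, h1.2, Pi.smul_apply, h2, smul_eq_mul]
    push_cast
    ring
  · filter_upwards [h, h'] with x h1 h2
    rw [h1.1, Pi.add_apply, h1.2, Pi.smul_apply, smul_eq_mul] at h2
    push_cast
    linear_combination h2

theorem mem_ofBounded_graph_iff {A : L2 →L[ℂ] L2} {f g : L2} :
    (f, g) ∈ (ofBounded A).graph ↔ A f = g := by
  rw [LinearPMap.mem_graph_iff]
  constructor
  · rintro ⟨y, rfl, rfl⟩
    rfl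
  · rintro rfl
    exact ⟨⟨f, Submodule.mem_top⟩, rfl, rfl⟩

theorem mem_opComp_graph_iff {S T : L2 →ₗ.[ℂ] L2} {f h : L2} :
    (f, h) ∈ (opComp S T).graph ↔ ∃ g, (f, g) ∈ T.graph ∧ (g, h) ∈ S.graph := by
  constructor
  · intro hfh
    obtain ⟨⟨y, hy1, hy2⟩, hy, hh⟩ := (LinearPMap.mem_graph_iff _).1 hfh
    simp only at hy hh
    subst hy
    rw [← hh]
    exact ⟨T ⟨y, hy1⟩, LinearPMap.mem_graph T ⟨y, hy1⟩, LinearPMap.mem_graph S ⟨_, hy2⟩⟩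
  · rintro ⟨g, hfg, hgh⟩
    obtain ⟨⟨y, hy1⟩, hy, hg⟩ := (LinearPMap.mem_graph_iff _).1 hfg
    simp only at hy hg
    subst hy hg
    obtain ⟨⟨y', hy2⟩, hy', hh⟩ := (LinearPMap.mem_graph_iff _).1 hgh
    simp only at hy' hh
    subst hy' hh
    exact (LinearPMap.mem_graph_iff _).2 ⟨⟨y, hy1, hy2⟩, rfl, rfl⟩

theorem mem_projectedPosition_graph_iff {P : L2 →L[ℂ] L2} {f h : L2} :
    (f, h) ∈ (projectedPosition P).graph ↔ ∃ g, (P f, g) ∈ position.graph ∧ P g = h := by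
  simp only [projectedPosition, mem_opComp_graph_iff, mem_ofBounded_graph_iff, exists_eq_left']

theorem position_graph_functional (f g g' : L2) (h : (f, g) ∈ position.graph)
    (h' : (f, g') ∈ position.graph) : g = g' :=
  LinearPMap.mem_graph_snd_inj _ h h' rfl

theorem isBoundedBy_of_graph {A : L2 →ₗ.[ℂ] L2} {C : ℝ}
    (h : ∀ f, ∃ g, (f, g) ∈ A.graph ∧ ‖g‖ ≤ C * ‖f‖) : IsBoundedBy A C := by
  refine ⟨Submodule.eq_top_iff'.2 fun f => ?_, fun f => ?_⟩
  · obtain ⟨g, hg, -⟩ := h f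
    exact LinearPMap.mem_domain_of_mem_graph hg
  · obtain ⟨g, hg, hn⟩ := h f
    rwa [LinearPMap.mem_graph_snd_inj A (LinearPMap.mem_graph A f) hg rfl]

theorem isBoundedOnPositionDomainBy_of_graph {A : L2 →ₗ.[ℂ] L2} {C : ℝ}
    (h : ∀ f g, (f, g) ∈ position.graph → ∃ k, (f, k) ∈ A.graph)
    (h' : ∀ f k, (f, k) ∈ A.graph → ‖k‖ ≤ C * ‖f‖) : IsBoundedOnPositionDomainBy A C := by
  refine ⟨fun f hf => ?_, fun f => h' _ _ (LinearPMap.mem_graph A f)⟩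
  obtain ⟨k, hk⟩ := h f _ (LinearPMap.mem_graph position ⟨f, hf⟩)
  exact LinearPMap.mem_domain_of_mem_graph hk

/-! ### Resolvents -/

theorem IsResolventAt.exists_graph {T : L2 →ₗ.[ℂ] L2} {z : ℂ} {R : L2 →L[ℂ] L2}
    (h : IsResolventAt T z R) (f : L2) : ∃ g, (R f, g) ∈ T.graph ∧ z • R f - g = f := by
  obtain ⟨hd, hT⟩ := h.1 f
  exact ⟨_, LinearPMap.mem_graph T ⟨R f, hd⟩, hT⟩

theorem IsResolventAt.apply_of_mem {T : L2 →ₗ.[ℂ] L2} {z : ℂ} {R : L2 →L[ℂ] L2}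
    (h : IsResolventAt T z R) {f g : L2} (hfg : (f, g) ∈ T.graph) : R (z • f - g) = f := by
  obtain ⟨y, hy, hg⟩ := (LinearPMap.mem_graph_iff _).1 hfg
  simp only at hy hg
  rw [← hy, ← hg]
  exact h.2 y

theorem opResolvent_spec {T : L2 →ₗ.[ℂ] L2} {z : ℂ} (h : z ∈ opResolventSet T) :
    IsResolventAt T z (opResolvent T z) := by
  have h' : ∃ R, IsResolventAt T z R := h
  rw [opResolvent, dif_pos h']
  exact h'.choose_spec

/-- The first resolvent identity for an unbounded operator. -/
theorem IsResolventAt.sub_eq {T : L2 →ₗ.[ℂ] L2} {z w : ℂ} {R S : L2 →L[ℂ] L2}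
    (hR : IsResolventAt T z R) (hS : IsResolventAt T w S) : S - R = (z - w) • (R ∘L S) := by
  ext1 f
  obtain ⟨g, hg, hw⟩ := hS.exists_graph f
  have := hR.apply_of_mem hg
  rw [show z • S f - g = f + (z - w) • S f by nth_rewrite 2 [← hw]; rw [sub_smul]; abel,
    map_add, map_smul] at this
  simp only [sub_apply, smul_apply, ContinuousLinearMap.comp_apply]
  nth_rewrite 1 [← this]
  abel

/-- The resolvent of `PXP`, restricted to `range P`, is a compressed resolvent. -/
theorem IsResolventAt.isCompressedResolvent {P R : L2 →L[ℂ] L2} (hP : ∀ f, P (P f) = P f) {z : ℂ}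
    (h : IsResolventAt (projectedPosition P) z R) :
    IsCompressedResolvent position.graph P z (R ∘L P) := by
  have left : ∀ u g f, (P u, g) ∈ position.graph → z • u - P g = f → R f = u := by
    rintro u g f hu rfl
    exact h.apply_of_mem (mem_projectedPosition_graph_iff.2 ⟨g, hu, rfl⟩)
  have right : ∀ f, ∃ g, (P (R f), g) ∈ position.graph ∧ z • R f - P g = f := by
    intro f
    obtain ⟨k, hk, hz⟩ := h.exists_graph f
    obtain ⟨g, hg, rfl⟩ := mem_projectedPosition_graph_iff.1 hk
    exact ⟨g, hg, hz⟩
  -- both `R P f` and `P R P f` solve `z u - P X P u = P f`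
  have range : ∀ f, P (R (P f)) = R (P f) := by
    intro f
    obtain ⟨g, hg, hz⟩ := right (P f)
    refine (left _ g (P f) (by rwa [hP]) ?_).symm
    have := congrArg P hz
    rwa [map_sub, map_smul, hP, hP] at this
  refine ⟨fun f => ?_, range, fun u g f hu hPu hz => ?_⟩
  · obtain ⟨g, hg, hz⟩ := right (P f)
    rw [range] at hg
    exact ⟨g, hg, hz⟩
  · exact (left u g (P f) (by rwa [hPu]) hz).symm

/-! ### Integral operators with exponentially decaying kernels -/

theorem integrable_exp_neg_mul_norm {γ : ℝ} (hγ : 0 < γ) :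
    Integrable fun y : Plane => Real.exp (-γ * ‖y‖) := by
  rw [integrable_fun_norm_addHaar (volume : Measure Plane) (f := fun t => Real.exp (-γ * t))]
  have := integrableOn_rpow_mul_exp_neg_mul_rpow (s := 1) (p := 1) (b := γ) (by norm_num)
    one_pos hγ
  simpa using this

/-- The integral `∫ exp (-γ |y|) dy` over the plane. -/
noncomputable def expMass (γ : ℝ) : ℝ := ∫ y : Plane, Real.exp (-γ * ‖y‖)

theorem expMass_nonneg (γ : ℝ) : 0 ≤ expMass γ := integral_nonneg fun _ => (Real.exp_pos _).le

theorem integrable_exp_neg_mul_norm_sub {γ : ℝ} (hγ : 0 < γ) (x : Plane) :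
    Integrable fun y : Plane => Real.exp (-γ * ‖x - y‖) :=
  (integrable_exp_neg_mul_norm hγ).comp_sub_left x

theorem integral_exp_neg_mul_norm_sub (γ : ℝ) (x : Plane) :
    ∫ y : Plane, Real.exp (-γ * ‖x - y‖) = expMass γ :=
  integral_sub_left_eq_self (fun y : Plane => Real.exp (-γ * ‖y‖)) volume x

theorem lintegral_exp_neg_mul_norm_sub {γ : ℝ} (hγ : 0 < γ) (x : Plane) :
    ∫⁻ y : Plane, ENNReal.ofReal (Real.exp (-γ * ‖x - y‖)) = ENNReal.ofReal (expMass γ) := by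
  rw [← integral_exp_neg_mul_norm_sub γ x, ofReal_integral_eq_lintegral_ofReal
    (integrable_exp_neg_mul_norm_sub hγ x) (ae_of_all _ fun _ => (Real.exp_pos _).le)]

/-- A jointly measurable kernel bounded by `C exp (-γ |x - y|)` everywhere. -/
structure IsExpKernel (k : Plane → Plane → ℂ) (C γ : ℝ) : Prop where
  measurable : Measurable (Function.uncurry k)
  norm_le : ∀ x y, ‖k x y‖ ≤ C * Real.exp (-γ * ‖x - y‖)

theorem exp_neg_mul_sq (γ t : ℝ) : Real.exp (-γ * t) ^ 2 = Real.exp (-(2 * γ) * t) := by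
  rw [← Real.exp_nat_mul]
  congr 1
  push_cast
  ring

theorem memLp_exp_neg_mul_norm_sub {γ : ℝ} (hγ : 0 < γ) (x : Plane) :
    MemLp (fun y : Plane => Real.exp (-γ * ‖x - y‖)) 2 := by
  rw [memLp_two_iff_integrable_sq (by fun_prop)]
  simp_rw [exp_neg_mul_sq]
  exact integrable_exp_neg_mul_norm_sub (by positivity) x

namespace IsExpKernel

variable {k : Plane → Plane → ℂ} {C γ : ℝ}

theorem measurable_apply (hk : IsExpKernel k C γ) (x : Plane) : Measurable (k x) :=
  hk.measurable.of_uncurry_left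

theorem memLp (hk : IsExpKernel k C γ) (hγ : 0 < γ) (x : Plane) : MemLp (k x) 2 :=
  (memLp_exp_neg_mul_norm_sub hγ x).of_le_mul (hk.measurable_apply x).aestronglyMeasurable
    (c := C) (ae_of_all _ fun y => by
      rw [Real.norm_of_nonneg (Real.exp_pos _).le]; exact hk.norm_le x y)

theorem integrable_mul (hk : IsExpKernel k C γ) (hγ : 0 < γ) (f : L2) (x : Plane) :
    Integrable fun y => k x y * f y :=
  (hk.memLp hγ x).integrable_mul (Lp.memLp f)

theorem stronglyMeasurable_integral (hk : IsExpKernel k C γ) (f : L2) :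
    StronglyMeasurable fun x => ∫ y, k x y * f y :=
  StronglyMeasurable.integral_prod_right (f := fun x y => k x y * f y)
    (hk.measurable.stronglyMeasurable.mul
      ((Lp.stronglyMeasurable f).comp_measurable measurable_snd))

/-- The pointwise step of Schur's test, from the Cauchy-Schwarz inequality. -/
theorem enorm_integral_sq_le (hk : IsExpKernel k C γ) (hγ : 0 < γ) (hC : 0 ≤ C) (f : L2)
    (x : Plane) :
    ‖∫ y, k x y * f y‖ₑ ^ 2 ≤ ENNReal.ofReal C ^ 2 * ENNReal.ofReal (expMass γ) *
      ∫⁻ y, ENNReal.ofReal (Real.exp (-γ * ‖x - y‖)) * ‖f y‖ₑ ^ 2 := by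
  set e : Plane → ℝ≥0∞ := fun y => ENNReal.ofReal (Real.exp (-(γ / 2) * ‖x - y‖)) with he
  have he2 : ∀ y, e y ^ 2 = ENNReal.ofReal (Real.exp (-γ * ‖x - y‖)) := fun y => by
    rw [he, ← ENNReal.ofReal_pow (Real.exp_pos _).le, exp_neg_mul_sq]
    congr 3; ring
  have hem : Measurable e := by fun_prop
  have h1 : ‖∫ y, k x y * f y‖ₑ ≤ ENNReal.ofReal C * ∫⁻ y, (e * fun y => e y * ‖f y‖ₑ) y := by
    rw [← lintegral_const_mul _ (by
      exact hem.mul (hem.mul (Lp.stronglyMeasurable f).measurable.enorm))]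
    refine (enorm_integral_le_lintegral_enorm _).trans (lintegral_mono fun y => ?_)
    simp only [Pi.mul_apply]
    rw [enorm_mul, ← mul_assoc, ← mul_assoc, mul_assoc (ENNReal.ofReal C), ← sq, he2,
      ← ENNReal.ofReal_mul hC]
    gcongr
    rw [← ofReal_norm]
    exact ENNReal.ofReal_le_ofReal (hk.norm_le x y)
  have h2 := ENNReal.lintegral_mul_le_Lp_mul_Lq volume (p := 2) (q := 2)
    ⟨by norm_num, by norm_num, by norm_num⟩ hem.aemeasurable (g := fun y => e y * ‖f y‖ₑ)
    (hem.mul (Lp.stronglyMeasurable f).measurable.enorm).aemeasurable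
  have h3 : (∫⁻ y, (e * fun y => e y * ‖f y‖ₑ) y) ^ 2 ≤ ENNReal.ofReal (expMass γ) *
      ∫⁻ y, ENNReal.ofReal (Real.exp (-γ * ‖x - y‖)) * ‖f y‖ₑ ^ 2 := by
    refine (pow_le_pow_left' h2 2).trans_eq ?_
    rw [mul_pow, ← ENNReal.rpow_mul_natCast, ← ENNReal.rpow_mul_natCast]
    simp only [Nat.cast_ofNat, one_div, ne_eq, OfNat.ofNat_ne_zero, not_false_eq_true,
      inv_mul_cancel₀, ENNReal.rpow_one, ENNReal.rpow_ofNat, mul_pow, he2]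
    rw [lintegral_exp_neg_mul_norm_sub hγ]
  calc _ ≤ (ENNReal.ofReal C * ∫⁻ y, (e * fun y => e y * ‖f y‖ₑ) y) ^ 2 := pow_le_pow_left' h1 2
    _ ≤ _ := by rw [mul_pow, mul_assoc]; gcongr

theorem lintegral_enorm_sq_le (hk : IsExpKernel k C γ) (hγ : 0 < γ) (hC : 0 ≤ C) (f : L2) :
    ∫⁻ x, ‖∫ y, k x y * f y‖ₑ ^ 2 ≤ ENNReal.ofReal (C * expMass γ) ^ 2 * ∫⁻ y, ‖f y‖ₑ ^ 2 := by
  have hf := (Lp.stronglyMeasurable f).measurable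
  calc _ ≤ ∫⁻ x, ENNReal.ofReal C ^ 2 * ENNReal.ofReal (expMass γ) *
        ∫⁻ y, ENNReal.ofReal (Real.exp (-γ * ‖x - y‖)) * ‖f y‖ₑ ^ 2 :=
        lintegral_mono fun x => hk.enorm_integral_sq_le hγ hC f x
    _ = ENNReal.ofReal C ^ 2 * ENNReal.ofReal (expMass γ) *
        ∫⁻ y, ∫⁻ x, ENNReal.ofReal (Real.exp (-γ * ‖y - x‖)) * ‖f y‖ₑ ^ 2 := by
      rw [lintegral_const_mul', lintegral_lintegral_swap]
      · simp_rw [norm_sub_rev]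
      · exact Measurable.aemeasurable (by unfold Function.uncurry; fun_prop)
      · finiteness
    _ = _ := by
      have : ∀ y : Plane, ∫⁻ x, ENNReal.ofReal (Real.exp (-γ * ‖y - x‖)) * ‖f y‖ₑ ^ 2 =
          ENNReal.ofReal (expMass γ) * ‖f y‖ₑ ^ 2 := fun y => by
        rw [lintegral_mul_const' _ _ (by finiteness), lintegral_exp_neg_mul_norm_sub hγ]
      simp_rw [this]
      rw [lintegral_const_mul' _ _ (by finiteness), ENNReal.ofReal_mul hC]
      ring

theorem eLpNorm_integral_le (hk : IsExpKernel k C γ) (hγ : 0 < γ) (hC : 0 ≤ C) (f : L2) :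
    eLpNorm (fun x => ∫ y, k x y * f y) 2 volume ≤
      ENNReal.ofReal (C * expMass γ) * eLpNorm f 2 volume := by
  have h := hk.lintegral_enorm_sq_le hγ hC f
  have h2 : ∀ g : Plane → ℂ, eLpNorm g 2 volume ^ 2 = ∫⁻ x, ‖g x‖ₑ ^ 2 := fun g => by
    have := eLpNorm_nnreal_pow_eq_lintegral (f := g) (p := 2) (μ := volume) (by norm_num)
    simpa using this
  rw [← h2, ← h2, ← mul_pow] at h
  exact (ENNReal.pow_le_pow_left_iff two_ne_zero).1 h

/-- Schur's test: an exponentially decaying kernel is the kernel of a bounded operator. -/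
theorem exists_operator (hk : IsExpKernel k C γ) (hγ : 0 < γ) (hC : 0 ≤ C) :
    ∃ A : L2 →L[ℂ] L2, (∀ f, (A f : Plane → ℂ) =ᵐ[volume] fun x => ∫ y, k x y * f y) ∧
      ‖A‖ ≤ C * expMass γ := by
  have hm : ∀ f : L2, MemLp (fun x => ∫ y, k x y * f y) 2 := fun f =>
    ⟨(hk.stronglyMeasurable_integral f).aestronglyMeasurable,
      (hk.eLpNorm_integral_le hγ hC f).trans_lt
        (ENNReal.mul_lt_top ENNReal.ofReal_lt_top (Lp.memLp f).2)⟩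
  let L : L2 →ₗ[ℂ] L2 :=
    { toFun := fun f => (hm f).toLp
      map_add' := fun f g => by
        rw [← MemLp.toLp_add]
        refine MemLp.toLp_congr _ _ (ae_of_all _ fun x => ?_)
        simp only [Pi.add_apply]
        rw [← integral_add (hk.integrable_mul hγ f x) (hk.integrable_mul hγ g x)]
        refine integral_congr_ae ?_
        filter_upwards [Lp.coeFn_add f g] with y hy
        rw [hy, Pi.add_apply, mul_add]
      map_smul' := fun c f => by
        rw [RingHom.id_apply, ← MemLp.toLp_const_smul]
        refine MemLp.toLp_congr _ _ (ae_of_all _ fun x => ?_)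
        simp only [Pi.smul_apply]
        rw [← integral_smul]
        refine integral_congr_ae ?_
        filter_upwards [Lp.coeFn_smul c f] with y hy
        rw [hy, Pi.smul_apply, smul_eq_mul, smul_eq_mul]
        ring }
  have hL : ∀ f, ‖L f‖ ≤ C * expMass γ * ‖f‖ := fun f => by
    have h0 : 0 ≤ C * expMass γ := mul_nonneg hC (expMass_nonneg γ)
    change ‖(hm f).toLp‖ ≤ _
    rw [Lp.norm_toLp, Lp.norm_def]
    refine (ENNReal.toReal_mono ?_ (hk.eLpNorm_integral_le hγ hC f)).trans_eq ?_
    · exact (ENNReal.mul_lt_top ENNReal.ofReal_lt_top (Lp.memLp f).2).ne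
    · rw [ENNReal.toReal_mul, ENNReal.toReal_ofReal h0]
  exact ⟨L.mkContinuous _ hL, fun f => MemLp.coeFn_toLp (hm f),
    L.mkContinuous_norm_le (mul_nonneg hC (expMass_nonneg γ)) hL⟩

end IsExpKernel

/-- `A` is the integral operator with kernel `k`. -/
def IsKernelOf (k : Plane → Plane → ℂ) (A : L2 →L[ℂ] L2) : Prop :=
  ∀ f, (A f : Plane → ℂ) =ᵐ[volume] fun x => ∫ y, k x y * f y

namespace IsExpKernel

variable {k l : Plane → Plane → ℂ} {A B : L2 →L[ℂ] L2} {C C' γ γ' : ℝ}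

theorem opNorm_le (hk : IsExpKernel k C γ) (hγ : 0 < γ) (hC : 0 ≤ C) (hA : IsKernelOf k A) :
    ‖A‖ ≤ C * expMass γ := by
  obtain ⟨B, hB, hBn⟩ := hk.exists_operator hγ hC
  rwa [show A = B from ContinuousLinearMap.ext fun f => Lp.ext ((hA f).trans (hB f).symm)]

theorem sub_isKernelOf (hk : IsExpKernel k C γ) (hl : IsExpKernel l C' γ') (hγ : 0 < γ)
    (hγ' : 0 < γ') (hA : IsKernelOf k A) (hB : IsKernelOf l B) :
    IsKernelOf (fun x y => k x y - l x y) (A - B) := fun f => by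
  rw [sub_apply]
  filter_upwards [hA f, hB f, Lp.coeFn_sub (A f) (B f)] with x h1 h2 h3
  rw [h3, Pi.sub_apply, h1, h2, ← integral_sub (hk.integrable_mul hγ f x)
    (hl.integrable_mul hγ' f x)]
  simp_rw [sub_mul]

/-- The commutator of the position operator with an integral operator with exponentially decaying
kernel `k` has the kernel `(x₁ - y₁) k(x, y)`, hence is bounded. -/
theorem exists_isCommutator (hk : IsExpKernel k C γ) (hγ : 0 < γ) (hC : 0 ≤ C)
    (hA : IsKernelOf k A) :
    ∃ B, IsCommutator position.graph A B ∧ ‖B‖ ≤ C * (2 / γ) * expMass (γ / 2) := by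
  have hk' : IsExpKernel (fun x y => ((x 0 - y 0 : ℝ) : ℂ) * k x y) (C * (2 / γ)) (γ / 2) := by
    refine ⟨?_, fun x y => ?_⟩
    · have := hk.measurable
      unfold Function.uncurry at this ⊢
      fun_prop
    · rw [norm_mul, Complex.norm_real]
      have h1 : ‖x 0 - y 0‖ ≤ ‖x - y‖ := PiLp.norm_apply_le (x - y) 0
      have h2 : ‖x - y‖ ≤ 2 / γ * Real.exp (γ / 2 * ‖x - y‖) := by
        rw [div_mul_eq_mul_div, le_div_iff₀ hγ]
        linarith [Real.add_one_le_exp (γ / 2 * ‖x - y‖)]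
      calc ‖x 0 - y 0‖ * ‖k x y‖
          ≤ (2 / γ * Real.exp (γ / 2 * ‖x - y‖)) * (C * Real.exp (-γ * ‖x - y‖)) := by
            gcongr
            · exact h1.trans h2
            · exact hk.norm_le x y
        _ = C * (2 / γ) * (Real.exp (γ / 2 * ‖x - y‖) * Real.exp (-γ * ‖x - y‖)) := by ring
        _ = _ := by rw [← Real.exp_add]; congr 2; ring
  obtain ⟨B, hB, hBn⟩ := hk'.exists_operator (half_pos hγ) (by positivity)
  refine ⟨B, fun f g hfg => ?_, hBn⟩
  rw [mem_position_graph_iff] at hfg ⊢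
  filter_upwards [hA f, hA g, hB f, Lp.coeFn_add (A g) (B f)] with x h1 h2 h3 h4
  rw [h4, Pi.add_apply, h1, h2, h3, ← integral_add (hk.integrable_mul hγ g x)
    (hk'.integrable_mul (half_pos hγ) f x), ← integral_const_mul]
  refine integral_congr_ae ?_
  filter_upwards [hfg] with y hy
  rw [hy]
  push_cast
  ring

end IsExpKernel

/-! ### Bounded multiplication operators and exponential weights -/

theorem exists_mulOperator {m : Plane → ℂ} (hm : Measurable m) {C : ℝ} (hC : ∀ x, ‖m x‖ ≤ C) :
    ∃ A : L2 →L[ℂ] L2, ∀ f, (A f : Plane → ℂ) =ᵐ[volume] fun x => m x * f x := by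
  have hmem : ∀ f : L2, MemLp (fun x => m x * f x) 2 := fun f =>
    (Lp.memLp f).of_le_mul (hm.aestronglyMeasurable.mul (Lp.aestronglyMeasurable f))
      (ae_of_all _ fun x => by rw [norm_mul]; gcongr; exact hC x)
  let L : L2 →ₗ[ℂ] L2 :=
    { toFun := fun f => (hmem f).toLp
      map_add' := fun f g => by
        rw [← MemLp.toLp_add]
        refine MemLp.toLp_congr _ _ ?_
        filter_upwards [Lp.coeFn_add f g] with y hy
        rw [hy, Pi.add_apply, mul_add, Pi.add_apply]
      map_smul' := fun c f => by
        rw [RingHom.id_apply, ← MemLp.toLp_const_smul]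
        refine MemLp.toLp_congr _ _ ?_
        filter_upwards [Lp.coeFn_smul c f] with y hy
        rw [hy, Pi.smul_apply, Pi.smul_apply, smul_eq_mul, smul_eq_mul]
        ring }
  refine ⟨L.mkContinuous C fun f => ?_, fun f => MemLp.coeFn_toLp (hmem f)⟩
  refine Lp.norm_le_mul_norm_of_ae_le_mul ?_
  filter_upwards [MemLp.coeFn_toLp (hmem f)] with x hx
  change ‖((hmem f).toLp : Plane → ℂ) x‖ ≤ _
  rw [hx, norm_mul]
  gcongr
  exact hC x

theorem continuous_expWeight (γ : ℝ) (a : Plane) : Continuous (expWeight γ a) := by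
  unfold expWeight
  fun_prop

theorem expWeight_pos (γ : ℝ) (a x : Plane) : 0 < expWeight γ a x := Real.exp_pos _

theorem one_le_expWeight {γ : ℝ} (hγ : 0 ≤ γ) (a x : Plane) : 1 ≤ expWeight γ a x :=
  Real.one_le_exp (by positivity)

theorem expWeight_eq (γ : ℝ) (a x : Plane) :
    expWeight γ a x = Real.exp (γ * Real.sqrt (1 + ‖x - a‖ ^ 2)) := by
  rw [expWeight, EuclideanSpace.norm_sq_eq, Fin.sum_univ_two]
  simp [add_assoc]

theorem sqrt_one_add_sq_le {s t u : ℝ} (h : |s - t| ≤ u) :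
    Real.sqrt (1 + s ^ 2) ≤ Real.sqrt (1 + t ^ 2) + u := by
  have hu : 0 ≤ u := (abs_nonneg _).trans h
  refine Real.sqrt_le_iff.2 ⟨by positivity, ?_⟩
  have h1 : t ≤ Real.sqrt (1 + t ^ 2) := Real.le_sqrt_of_sq_le (by linarith)
  have h1' : -t ≤ Real.sqrt (1 + t ^ 2) := Real.le_sqrt_of_sq_le (by linarith [neg_sq t])
  have h2 : Real.sqrt (1 + t ^ 2) ^ 2 = 1 + t ^ 2 := Real.sq_sqrt (by positivity)
  obtain ⟨h3, h4⟩ := abs_le.1 h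
  have h5 : (s - t) ^ 2 ≤ u ^ 2 := sq_le_sq' h3 h4
  have h6 : t * (s - t) ≤ Real.sqrt (1 + t ^ 2) * u := by
    refine (le_abs_self _).trans ?_
    rw [abs_mul]
    exact mul_le_mul (abs_le.2 ⟨by linarith, h1⟩) h (abs_nonneg _) (Real.sqrt_nonneg _)
  nlinarith

theorem expWeight_le_mul {γ : ℝ} (hγ : 0 ≤ γ) (a x y : Plane) :
    expWeight γ a x ≤ expWeight γ a y * Real.exp (γ * ‖x - y‖) := by
  rw [expWeight_eq, expWeight_eq, ← Real.exp_add, ← mul_add]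
  gcongr
  refine sqrt_one_add_sq_le ?_
  have := abs_norm_sub_norm_le (x - a) (y - a)
  rwa [sub_sub_sub_cancel_right] at this

theorem expWeight_div_le {γ : ℝ} (hγ : 0 ≤ γ) (a x y : Plane) :
    expWeight γ a x / expWeight γ a y ≤ Real.exp (γ * ‖x - y‖) := by
  rw [div_le_iff₀ (expWeight_pos _ _ _), mul_comm]
  exact expWeight_le_mul hγ a x y

theorem abs_expWeight_div_sub_one_le {γ : ℝ} (hγ : 0 ≤ γ) (a x y : Plane) :
    |expWeight γ a x / expWeight γ a y - 1| ≤ γ * ‖x - y‖ * Real.exp (γ * ‖x - y‖) := by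
  set t := γ * ‖x - y‖
  have ht : 0 ≤ t := by positivity
  have h1 := expWeight_div_le hγ a x y
  have h2 : Real.exp (-t) ≤ expWeight γ a x / expWeight γ a y := by
    rw [le_div_iff₀ (expWeight_pos _ _ _), Real.exp_neg, inv_mul_le_iff₀ (Real.exp_pos _), mul_comm]
    have := expWeight_le_mul hγ a y x
    rwa [norm_sub_rev] at this
  have h3 := Real.add_one_le_exp (-t)
  have h4 : Real.exp t - 1 ≤ t * Real.exp t := by
    have : Real.exp (-t) * Real.exp t = 1 := by rw [← Real.exp_add]; simp
    nlinarith [Real.exp_pos t]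
  have h5 : t ≤ t * Real.exp t := le_mul_of_one_le_right ht (Real.one_le_exp ht)
  exact abs_le.2 ⟨by linarith, by linarith⟩

/-- `W` is multiplication by the bounded function `1 / expWeight γ a`. -/
def IsInvWeight (γ : ℝ) (a : Plane) (W : L2 →L[ℂ] L2) : Prop :=
  ∀ f, (W f : Plane → ℂ) =ᵐ[volume] fun x => ((expWeight γ a x)⁻¹ : ℂ) * f x

theorem exists_isInvWeight {γ : ℝ} (hγ : 0 ≤ γ) (a : Plane) : ∃ W, IsInvWeight γ a W :=
  exists_mulOperator (C := 1)
    (by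
      have := continuous_expWeight γ a
      exact (Complex.measurable_ofReal.comp this.measurable).inv)
    fun x => by
      rw [norm_inv, Complex.norm_real, Real.norm_of_nonneg (expWeight_pos _ _ _).le]
      exact inv_le_one_of_one_le₀ (one_le_expWeight hγ a x)

namespace IsInvWeight

variable {γ : ℝ} {a : Plane} {W : L2 →L[ℂ] L2}

theorem injective (hW : IsInvWeight γ a W) : Function.Injective W := fun f g h => by
  refine Lp.ext ?_
  have h1 := hW f
  rw [h] at h1
  filter_upwards [h1, hW g] with x h2 h3
  rw [h2] at h3
  refine (mul_left_cancel₀ ?_ h3)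
  exact inv_ne_zero (Complex.ofReal_ne_zero.2 (expWeight_pos _ _ _).ne')

theorem position_graph (hW : IsInvWeight γ a W) (f g : L2) (h : (f, g) ∈ position.graph) :
    (W f, W g) ∈ position.graph := by
  rw [mem_position_graph_iff] at h ⊢
  filter_upwards [h, hW f, hW g] with x h1 h2 h3
  rw [h2, h3, h1]
  ring

end IsInvWeight

/-- The tilted operator `P' = W⁻¹ P W` of an operator `P` with exponentially decaying kernel `k` has
the kernel `w(x) k(x, y) / w(y)`; it is bounded, so is its commutator with the position operator,
and it is close to `P` when `γ` is small, all uniformly in the centre `a`. -/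
theorem IsExpKernel.exists_tilt {k : Plane → Plane → ℂ} {P : L2 →L[ℂ] L2} {C γ₀ γ : ℝ}
    (hk : IsExpKernel k C γ₀) (hγ₀ : 0 < γ₀) (hC : 0 ≤ C) (hP : IsKernelOf k P) (hγ : 0 ≤ γ)
    (hγ' : γ ≤ γ₀ / 2) {a : Plane} {W : L2 →L[ℂ] L2} (hW : IsInvWeight γ a W) :
    ∃ P' A' : L2 →L[ℂ] L2, (∀ f, P (W f) = W (P' f)) ∧ IsCommutator position.graph P' A' ∧
      ‖P'‖ ≤ C * expMass (γ₀ / 2) ∧ ‖A'‖ ≤ C * (4 / γ₀) * expMass (γ₀ / 4) ∧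
      ‖P' - P‖ ≤ γ * (C * (4 / γ₀) * expMass (γ₀ / 4)) := by
  have hw := (continuous_expWeight γ a).measurable
  have hkm := hk.measurable
  have hk' : IsExpKernel (fun x y => ((expWeight γ a x / expWeight γ a y : ℝ) : ℂ) * k x y) C
      (γ₀ / 2) := by
    refine ⟨?_, fun x y => ?_⟩
    · unfold Function.uncurry at hkm ⊢
      fun_prop
    · rw [norm_mul, Complex.norm_real, Real.norm_of_nonneg
        (div_nonneg (expWeight_pos _ _ _).le (expWeight_pos _ _ _).le)]
      calc _ ≤ Real.exp (γ₀ / 2 * ‖x - y‖) * (C * Real.exp (-γ₀ * ‖x - y‖)) := by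
            gcongr
            · exact (expWeight_div_le hγ a x y).trans (by gcongr)
            · exact hk.norm_le x y
        _ = C * (Real.exp (γ₀ / 2 * ‖x - y‖) * Real.exp (-γ₀ * ‖x - y‖)) := by ring
        _ = _ := by rw [← Real.exp_add]; congr 2; ring
  obtain ⟨P', hP', hPn⟩ := hk'.exists_operator (half_pos hγ₀) hC
  obtain ⟨A', hA', hAn⟩ := hk'.exists_isCommutator (half_pos hγ₀) hC hP'
  refine ⟨P', A', fun f => Lp.ext ?_, hA', hPn, ?_, ?_⟩
  · filter_upwards [hP (W f), hW (P' f), hP' f] with x h1 h2 h3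
    rw [h1, h2, h3, ← integral_const_mul]
    refine integral_congr_ae ?_
    filter_upwards [hW f] with y hy
    have := (Complex.ofReal_ne_zero.2 (expWeight_pos γ a x).ne')
    rw [hy]
    push_cast
    field_simp
  · convert hAn using 2
    · congr 1; field_simp; norm_num
    · congr 1; ring
  · have hd := hk'.sub_isKernelOf hk (half_pos hγ₀) hγ₀ hP' hP
    have hd' : IsExpKernel
        (fun x y => ((expWeight γ a x / expWeight γ a y : ℝ) : ℂ) * k x y - k x y)
        (γ * (C * (4 / γ₀))) (γ₀ / 4) := by
      refine ⟨?_, fun x y => ?_⟩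
      · unfold Function.uncurry at hkm ⊢
        fun_prop
      · rw [← sub_one_mul, norm_mul, ← Complex.ofReal_one, ← Complex.ofReal_sub, Complex.norm_real,
          Real.norm_eq_abs]
        have h2 : ‖x - y‖ ≤ 4 / γ₀ * Real.exp (γ₀ / 4 * ‖x - y‖) := by
          rw [div_mul_eq_mul_div, le_div_iff₀ hγ₀]
          linarith [Real.add_one_le_exp (γ₀ / 4 * ‖x - y‖)]
        calc _ ≤ (γ * (4 / γ₀ * Real.exp (γ₀ / 4 * ‖x - y‖)) * Real.exp (γ₀ / 2 * ‖x - y‖)) *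
              (C * Real.exp (-γ₀ * ‖x - y‖)) := by
              gcongr
              · exact (abs_expWeight_div_sub_one_le hγ a x y).trans (by gcongr)
              · exact hk.norm_le x y
          _ = γ * (C * (4 / γ₀)) * (Real.exp (γ₀ / 4 * ‖x - y‖) * Real.exp (γ₀ / 2 * ‖x - y‖) *
              Real.exp (-γ₀ * ‖x - y‖)) := by ring
          _ = _ := by rw [← Real.exp_add, ← Real.exp_add]; congr 2; ring
    refine (hd'.opNorm_le (by positivity) (by positivity) hd).trans_eq ?_
    ring

/-! ### Kernels of operators with bounded tilts -/

/-- In a separable Hilbert space, orthonormal families are countable. -/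
theorem countable_of_orthonormal {H ι : Type*} [NormedAddCommGroup H] [InnerProductSpace ℂ H]
    [TopologicalSpace.SeparableSpace H] {b : ι → H} (hb : Orthonormal ℂ b) : Countable ι := by
  have hd : ∀ i j, i ≠ j → 1 ≤ dist (b i) (b j) := fun i j hij => by
    have h1 := norm_sub_sq (𝕜 := ℂ) (b i) (b j)
    rw [hb.2 hij, hb.1, hb.1] at h1
    rw [dist_eq_norm]
    norm_num at h1
    nlinarith [norm_nonneg (b i - b j)]
  have h := Set.PairwiseDisjoint.countable_of_isOpen (a := (Set.univ : Set ι))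
    (s := fun i => Metric.ball (b i) (1 / 2)) (fun i _ j _ hij =>
      Metric.ball_disjoint_ball (by linarith [hd i j hij]))
    (fun i _ => Metric.isOpen_ball) (fun i _ => ⟨b i, Metric.mem_ball_self (by norm_num)⟩)
  exact Set.countable_univ_iff.1 h

theorem norm_le_of_ae_le_exp {γ D : ℝ} (hγ : 0 < γ) (hD : 0 ≤ D) {f : L2} {x : Plane}
    (hf : ∀ᵐ y, ‖f y‖ ≤ D * Real.exp (-(γ / 2) * ‖x - y‖)) :
    ‖f‖ ≤ D * Real.sqrt (expMass γ) := by
  have h1 : ‖f‖ ^ 2 = ∫ y, ‖f y‖ ^ 2 := by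
    have h : (⟪f, f⟫_ℂ) = ∫ y, ((‖f y‖ ^ 2 : ℝ) : ℂ) := by
      rw [L2.inner_def]
      refine integral_congr_ae (ae_of_all _ fun y => ?_)
      simp only [inner_self_eq_norm_sq_to_K]
      push_cast
      rfl
    rw [inner_self_eq_norm_sq_to_K, integral_complex_ofReal] at h
    exact Complex.ofReal_injective ((Complex.ofReal_pow _ _).trans h)
  have h2 : ‖f‖ ^ 2 ≤ D ^ 2 * expMass γ := by
    rw [h1, ← integral_exp_neg_mul_norm_sub γ x, ← integral_const_mul]
    refine integral_mono_of_nonneg (ae_of_all _ fun y => by positivity)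
      ((integrable_exp_neg_mul_norm_sub hγ x).const_mul _) ?_
    filter_upwards [hf] with y hy
    calc ‖f y‖ ^ 2 ≤ (D * Real.exp (-(γ / 2) * ‖x - y‖)) ^ 2 := by gcongr
      _ = _ := by rw [mul_pow, exp_neg_mul_sq]; congr 3; ring
  refine abs_le_of_sq_le_sq' ?_ (by positivity) |>.2
  rwa [mul_pow, Real.sq_sqrt (expMass_nonneg γ)]

namespace IsExpKernel

variable {k : Plane → Plane → ℂ} {P Q : L2 →L[ℂ] L2} {C γ γ₀ M : ℝ}

theorem memLp_conj (hk : IsExpKernel k C γ) (hγ : 0 < γ) (x : Plane) :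
    MemLp (fun y => conj (k x y)) 2 :=
  (hk.memLp hγ x).of_le_mul (c := 1)
    (Complex.continuous_conj.measurable.comp (hk.measurable_apply x)).aestronglyMeasurable
    (ae_of_all _ fun y => by simp)

/-- The row `conj k(x, ·)` of the kernel, as a vector of `L²`. -/
noncomputable def row (hk : IsExpKernel k C γ) (hγ : 0 < γ) (x : Plane) : L2 :=
  (hk.memLp_conj hγ x).toLp

theorem coeFn_row (hk : IsExpKernel k C γ) (hγ : 0 < γ) (x : Plane) :
    hk.row hγ x =ᵐ[volume] fun y => conj (k x y) :=
  MemLp.coeFn_toLp _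

theorem inner_row (hk : IsExpKernel k C γ) (hγ : 0 < γ) (x : Plane) (f : L2) :
    ⟪hk.row hγ x, f⟫_ℂ = ∫ y, k x y * f y := by
  rw [L2.inner_def]
  refine integral_congr_ae ?_
  filter_upwards [hk.coeFn_row hγ x] with y hy
  rw [hy, RCLike.inner_apply, RCLike.conj_conj, mul_comm]

/-- The map `(x, y) ↦ ⟪row x, Q (row y)⟫` is measurable: expand in a Hilbert basis. -/
theorem stronglyMeasurable_inner_row (hk : IsExpKernel k C γ) (hγ : 0 < γ) (Q : L2 →L[ℂ] L2) :
    StronglyMeasurable fun p : Plane × Plane => ⟪hk.row hγ p.1, Q (hk.row hγ p.2)⟫_ℂ := by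
  obtain ⟨ι, b, -⟩ := exists_hilbertBasis ℂ L2
  have : Fact ((2 : ℝ≥0∞) ≠ ⊤) := ⟨ENNReal.ofNat_ne_top⟩
  have : Countable ι := countable_of_orthonormal b.orthonormal
  have hm : ∀ f : L2, StronglyMeasurable fun x => ⟪hk.row hγ x, f⟫_ℂ := fun f => by
    simp_rw [hk.inner_row hγ]
    exact hk.stronglyMeasurable_integral f
  refine stronglyMeasurable_of_tendsto (Filter.atTop : Filter (Finset ι))
    (f := fun s p => ∑ i ∈ s, ⟪hk.row hγ p.1, b i⟫_ℂ * ⟪b i, Q (hk.row hγ p.2)⟫_ℂ)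
    (fun s => ?_) ?_
  · refine Finset.stronglyMeasurable_fun_sum s fun i _ => ?_
    refine ((hm (b i)).comp_measurable measurable_fst).mul ?_
    have : (fun p : Plane × Plane => ⟪b i, Q (hk.row hγ p.2)⟫_ℂ) =
        fun p => conj (⟪hk.row hγ p.2, ContinuousLinearMap.adjoint Q (b i)⟫_ℂ) := by
      ext p
      rw [inner_conj_symm, ContinuousLinearMap.adjoint_inner_left]
    rw [this]
    exact Complex.continuous_conj.comp_stronglyMeasurable ((hm _).comp_measurable measurable_snd)
  · rw [tendsto_pi_nhds]
    exact fun p => b.hasSum_inner_mul_inner _ _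

/-- If `P = P*` has the exponentially decaying kernel `k`, then `P Q P` has the kernel
`⟪row x, Q (row y)⟫`. -/
theorem isIntegralKernel_inner_row (hk : IsExpKernel k C γ) (hγ : 0 < γ) (hP : IsKernelOf k P)
    (hsa : ∀ f g, ⟪P f, g⟫_ℂ = ⟪f, P g⟫_ℂ) (hPQ : ∀ f, P (Q f) = Q f) (hQP : ∀ f, Q (P f) = Q f) :
    IsIntegralKernel (fun p => ⟪hk.row hγ p.1, Q (hk.row hγ p.2)⟫_ℂ) Q := by
  refine ⟨(hk.stronglyMeasurable_inner_row hγ Q).aestronglyMeasurable, fun f => ?_⟩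
  filter_upwards [hP (Q f)] with x hx
  set g := ContinuousLinearMap.adjoint Q (hk.row hγ x)
  have h1 : (fun y => ⟪hk.row hγ x, Q (hk.row hγ y)⟫_ℂ * f y) =ᵐ[volume] fun y =>
      ⟪(P g) y, f y⟫_ℂ := by
    filter_upwards [hP g] with y hy
    rw [hy, ← hk.inner_row hγ, RCLike.inner_apply, inner_conj_symm,
      ContinuousLinearMap.adjoint_inner_left, mul_comm]
  refine ⟨(L2.integrable_inner (𝕜 := ℂ) (P g) f).congr h1.symm, ?_⟩
  rw [integral_congr_ae h1, ← L2.inner_def, hsa, ContinuousLinearMap.adjoint_inner_left, hQP,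
    hk.inner_row, ← hx, hPQ]

/-- If the tilts of `Q = P Q P` by the weights centred at all points are uniformly bounded, then
the kernel of `Q` decays exponentially. -/
theorem hasExpBoundedKernel (hk : IsExpKernel k C γ₀) (hγ₀ : 0 < γ₀) (hC : 0 ≤ C)
    (hP : IsKernelOf k P) (hsa : ∀ f g, ⟪P f, g⟫_ℂ = ⟪f, P g⟫_ℂ) (hPQ : ∀ f, P (Q f) = Q f)
    (hQP : ∀ f, Q (P f) = Q f) (hγ : 0 ≤ γ) (hγ' : γ ≤ γ₀ / 2) (hM : 0 ≤ M)
    (hQ : ∀ a, ∃ W Q' : L2 →L[ℂ] L2, IsInvWeight γ a W ∧ (∀ f, Q (W f) = W (Q' f)) ∧ ‖Q'‖ ≤ M) :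
    HasExpBoundedKernel Q (C ^ 2 * Real.exp γ * expMass γ₀ * M) γ := by
  refine ⟨_, hk.isIntegralKernel_inner_row hγ₀ hP hsa hPQ hQP, ae_of_all _ fun p => ?_⟩
  obtain ⟨x, x'⟩ := p
  simp only
  -- tilt with the weight centred at the second variable
  obtain ⟨W, Q', hW, hQW, hQ'⟩ := hQ x'
  have hdec : ∀ y y' : Plane, Real.exp (γ * ‖y - y'‖) * Real.exp (-γ₀ * ‖y - y'‖) ≤
      Real.exp (-(γ₀ / 2) * ‖y - y'‖) := fun y y' => by
    rw [← Real.exp_add]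
    gcongr
    nlinarith [norm_nonneg (y - y')]
  have hwle : ∀ y, expWeight γ x' y ≤ Real.exp γ * Real.exp (γ * ‖x' - y‖) := fun y => by
    have := expWeight_le_mul hγ x' y x'
    rw [norm_sub_rev] at this
    rwa [expWeight_eq γ x' x', sub_self, norm_zero, zero_pow two_ne_zero, add_zero, Real.sqrt_one,
      mul_one] at this
  have hwge : ∀ y, (expWeight γ x' y)⁻¹ ≤ Real.exp (-(γ * ‖x' - y‖)) := fun y => by
    rw [Real.exp_neg, norm_sub_rev, expWeight_eq]
    refine inv_anti₀ (Real.exp_pos _) (Real.exp_le_exp.2 ?_)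
    gcongr
    exact Real.le_sqrt_of_sq_le (by linarith)
  have hvm : MemLp (fun y => (expWeight γ x' y : ℂ) * conj (k x' y)) 2 := by
    refine (memLp_exp_neg_mul_norm_sub (half_pos hγ₀) x').of_le_mul (c := Real.exp γ * C) ?_
      (ae_of_all _ fun y => ?_)
    · refine Measurable.aestronglyMeasurable ?_
      have h1 := hk.measurable_apply x'
      have h2 := (continuous_expWeight γ x').measurable
      exact (Complex.measurable_ofReal.comp h2).mul (Complex.continuous_conj.measurable.comp h1)
    · rw [norm_mul, Complex.norm_real, Real.norm_of_nonneg (expWeight_pos _ _ _).le,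
        RCLike.norm_conj, Real.norm_of_nonneg (Real.exp_pos _).le]
      calc _ ≤ (Real.exp γ * Real.exp (γ * ‖x' - y‖)) * (C * Real.exp (-γ₀ * ‖x' - y‖)) := by
            gcongr
            · exact hwle y
            · exact hk.norm_le x' y
        _ = Real.exp γ * C * (Real.exp (γ * ‖x' - y‖) * Real.exp (-γ₀ * ‖x' - y‖)) := by ring
        _ ≤ _ := by gcongr; exact hdec _ _
  set v : L2 := hvm.toLp with hv
  have hWv : W v = hk.row hγ₀ x' := by
    refine Lp.ext ?_
    filter_upwards [hW v, hvm.coeFn_toLp, hk.coeFn_row hγ₀ x'] with y h1 h2 h3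
    have := Complex.ofReal_ne_zero.2 (expWeight_pos γ x' y).ne'
    rw [h1, hv, h2, h3]
    field_simp
  have hvn : ‖v‖ ≤ Real.exp γ * C * Real.sqrt (expMass γ₀) := by
    refine norm_le_of_ae_le_exp hγ₀ (by positivity) (x := x') ?_
    filter_upwards [hvm.coeFn_toLp] with y hy
    rw [hv, hy, norm_mul, Complex.norm_real, Real.norm_of_nonneg (expWeight_pos _ _ _).le,
      RCLike.norm_conj]
    calc _ ≤ (Real.exp γ * Real.exp (γ * ‖x' - y‖)) * (C * Real.exp (-γ₀ * ‖x' - y‖)) := by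
          gcongr
          · exact hwle y
          · exact hk.norm_le x' y
      _ = Real.exp γ * C * (Real.exp (γ * ‖x' - y‖) * Real.exp (-γ₀ * ‖x' - y‖)) := by ring
      _ ≤ _ := by gcongr; exact hdec _ _
  have hun : ‖W (hk.row hγ₀ x)‖ ≤ C * Real.exp (-γ * ‖x - x'‖) * Real.sqrt (expMass γ₀) := by
    refine norm_le_of_ae_le_exp hγ₀ (by positivity) (x := x) ?_
    filter_upwards [hW (hk.row hγ₀ x), hk.coeFn_row hγ₀ x] with y h1 h2
    rw [h1, h2, norm_mul, norm_inv, Complex.norm_real,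
      Real.norm_of_nonneg (expWeight_pos _ _ _).le, RCLike.norm_conj]
    calc _ ≤ Real.exp (-(γ * ‖x' - y‖)) * (C * Real.exp (-γ₀ * ‖x - y‖)) := by
          gcongr
          · exact hwge y
          · exact hk.norm_le x y
      _ ≤ (Real.exp (-γ * ‖x - x'‖) * Real.exp (γ * ‖x - y‖)) * (C * Real.exp (-γ₀ * ‖x - y‖)) := by
          gcongr
          rw [← Real.exp_add]
          gcongr
          have := norm_sub_le_norm_sub_add_norm_sub x y x'
          rw [norm_sub_rev y x'] at this
          nlinarith
      _ = C * Real.exp (-γ * ‖x - x'‖) * (Real.exp (γ * ‖x - y‖) * Real.exp (-γ₀ * ‖x - y‖)) := by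
          ring
      _ ≤ _ := by gcongr; exact hdec _ _
  have hWsa : ∀ f g : L2, ⟪f, W g⟫_ℂ = ⟪W f, g⟫_ℂ := fun f g => by
    rw [L2.inner_def, L2.inner_def]
    refine integral_congr_ae ?_
    filter_upwards [hW f, hW g] with y h1 h2
    rw [h1, h2]
    simp only [RCLike.inner_apply, map_mul, map_inv₀, Complex.conj_ofReal]
    ring
  rw [← hWv, hQW, hWsa]
  calc _ ≤ ‖W (hk.row hγ₀ x)‖ * ‖Q' v‖ := norm_inner_le_norm _ _
    _ ≤ (C * Real.exp (-γ * ‖x - x'‖) * Real.sqrt (expMass γ₀)) *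
        (M * (Real.exp γ * C * Real.sqrt (expMass γ₀))) := by
        gcongr
        exact (Q'.le_of_opNorm_le hQ' v).trans (by gcongr)
    _ = C ^ 2 * Real.exp γ * (Real.sqrt (expMass γ₀) ^ 2) * M * Real.exp (-γ * ‖x - x'‖) := by ring
    _ = _ := by rw [Real.sq_sqrt (expMass_nonneg γ₀)]

end IsExpKernel

/-- An exponentially localized kernel can be modified on a null set so that it is measurable and
the bound holds everywhere. -/
theorem HasExpBoundedKernel.exists_isExpKernel {P : L2 →L[ℂ] L2} {C γ : ℝ} (hC : 0 ≤ C)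
    (h : HasExpBoundedKernel P C γ) : ∃ k, IsExpKernel k C γ ∧ IsKernelOf k P := by
  obtain ⟨k, ⟨hkm, hk⟩, hb⟩ := h
  let l := hkm.mk k
  have hl : StronglyMeasurable l := hkm.stronglyMeasurable_mk
  let s : Set (Plane × Plane) := {p | ‖l p‖ ≤ C * Real.exp (-γ * ‖p.1 - p.2‖)}
  have hs : MeasurableSet s := measurableSet_le hl.measurable.norm (by fun_prop)
  have hkl : k =ᵐ[volume] s.indicator l := by
    filter_upwards [hkm.ae_eq_mk, hb] with p h1 h2
    have : p ∈ s := by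
      change ‖l p‖ ≤ _
      rwa [show l p = k p from h1.symm]
    rw [Set.indicator_of_mem this]
    exact h1
  refine ⟨fun x y => s.indicator l (x, y), ⟨hl.measurable.indicator hs, fun x y => ?_⟩, fun f => ?_⟩
  · by_cases hxy : (x, y) ∈ s
    · rw [Set.indicator_of_mem hxy]
      exact hxy
    · rw [Set.indicator_of_notMem hxy, norm_zero]
      positivity
  · filter_upwards [hk f, Measure.ae_ae_of_ae_prod (μ := volume) (ν := volume) hkl] with x h1 h2
    rw [h1.2]
    refine integral_congr_ae ?_
    filter_upwards [h2] with y hy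
    rw [hy]

/-! ### Contours and contour integrals -/

theorem IsClosedContour.norm_sub_le {c : ℝ → ℂ} (hc : IsClosedContour c) {s t : ℝ}
    (hs : s ∈ Set.Icc (0 : ℝ) 1) (ht : t ∈ Set.Icc (0 : ℝ) 1) : ‖c t - c s‖ ≤ contourLength c := by
  obtain ⟨S, hS, -⟩ := hc.piecewise
  have hsub : Set.uIcc s t ⊆ Set.Icc 0 1 := Set.uIcc_subset_Icc hs ht
  have hint : IntervalIntegrable (deriv c) volume s t :=
    hc.integrable.mono_set (by rwa [Set.uIcc_of_le zero_le_one])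
  rw [← integral_eq_of_hasDerivAt_off_countable c (deriv c) S.countable_toSet
    (hc.continuousOn.mono hsub) (fun x hx => ?_) hint]
  · refine intervalIntegral.norm_integral_le_integral_norm_uIoc.trans ?_
    rw [contourLength, intervalIntegral.integral_of_le zero_le_one]
    refine setIntegral_mono_set hc.integrable.norm.1 (ae_of_all _ fun _ => norm_nonneg _) ?_
    refine Filter.Eventually.of_forall fun x hx => ?_
    rcases Set.mem_uIoc.1 hx with h | h
    · exact ⟨hs.1.trans_lt h.1, h.2.trans ht.2⟩
    · exact ⟨ht.1.trans_lt h.1, h.2.trans hs.2⟩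
  · refine (hS x ⟨?_, ?_⟩ hx.2).hasDerivAt
    · exact (le_min hs.1 ht.1).trans_lt hx.1.1
    · exact hx.1.2.trans_le (max_le hs.2 ht.2)

/-- A contour of length at most `L` that winds once around `z` comes within distance `L` of `z`,
since otherwise the winding integral is too small; hence it stays within distance `2 L` of `z`. -/
theorem IsClosedContour.norm_sub_le_of_windingNumber {c : ℝ → ℂ} (hc : IsClosedContour c) {L : ℝ}
    (hL : 0 < L) (hcL : contourLength c ≤ L) {z : ℂ} (hz : windingNumber c z = 1) {t : ℝ}
    (ht : t ∈ Set.Icc (0 : ℝ) 1) : ‖c t - z‖ ≤ 2 * L := by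
  by_contra! h
  have hfar : ∀ s ∈ Set.Icc (0 : ℝ) 1, L ≤ ‖c s - z‖ := fun s hs => by
    have h1 := hc.norm_sub_le hs ht
    have h2 := norm_sub_le_norm_sub_add_norm_sub (c t) (c s) z
    linarith
  have hint : ‖∫ t in (0 : ℝ)..1, deriv c t / (c t - z)‖ ≤ L⁻¹ * contourLength c := by
    rw [contourLength, ← intervalIntegral.integral_const_mul]
    refine intervalIntegral.norm_integral_le_of_norm_le zero_le_one
      (ae_of_all _ fun s hs => ?_) (hc.integrable.norm.const_mul _)
    have := hfar s ⟨hs.1.le, hs.2⟩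
    rw [norm_div, div_eq_inv_mul]
    gcongr
  have h1 : ‖windingNumber c z‖ ≤ (2 * Real.pi)⁻¹ := by
    rw [windingNumber, norm_mul, norm_inv, norm_mul, norm_mul, Complex.norm_I, Complex.norm_real,
      Real.norm_of_nonneg Real.pi_pos.le, Complex.norm_two, mul_one]
    refine mul_le_of_le_one_right (by positivity) (hint.trans ?_)
    rwa [inv_mul_le_iff₀ hL, mul_one]
  rw [hz, norm_one, one_le_inv₀ (by positivity)] at h1
  linarith [Real.pi_gt_three]

/-- The operator-valued contour integral `(2πi)⁻¹ ∫ c'(t) F(t) dt`. -/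
noncomputable def contourIntegral (c : ℝ → ℂ) (F : ℝ → L2 →L[ℂ] L2) : L2 →L[ℂ] L2 :=
  (2 * Real.pi * Complex.I : ℂ)⁻¹ • ∫ t in (0 : ℝ)..1, deriv c t • F t

section ContourIntegral

variable {c : ℝ → ℂ} {F F' : ℝ → L2 →L[ℂ] L2}

theorem contourIntegral_congr (h : ∀ t ∈ Set.Icc (0 : ℝ) 1, F t = F' t) :
    contourIntegral c F = contourIntegral c F' := by
  rw [contourIntegral, contourIntegral, intervalIntegral.integral_congr fun t ht => ?_]
  rw [Set.uIcc_of_le zero_le_one] at ht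
  simp only [h t ht]

theorem IsClosedContour.intervalIntegrable (hc : IsClosedContour c)
    (hF : ContinuousOn F (Set.Icc 0 1)) :
    IntervalIntegrable (fun t => deriv c t • F t) volume 0 1 :=
  hc.integrable.smul_continuousOn (by rwa [Set.uIcc_of_le zero_le_one])

theorem IsClosedContour.norm_contourIntegral_le (hc : IsClosedContour c) {M : ℝ}
    (hF : ∀ t ∈ Set.Icc (0 : ℝ) 1, ‖F t‖ ≤ M) : ‖contourIntegral c F‖ ≤ M * contourLength c := by
  have hM : 0 ≤ M := (norm_nonneg _).trans (hF 0 ⟨le_rfl, zero_le_one⟩)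
  have h1 : ‖∫ t in (0 : ℝ)..1, deriv c t • F t‖ ≤ M * contourLength c := by
    rw [contourLength, ← intervalIntegral.integral_const_mul]
    refine intervalIntegral.norm_integral_le_of_norm_le zero_le_one
      (ae_of_all _ fun s hs => ?_) (hc.integrable.norm.const_mul _)
    rw [norm_smul, mul_comm]
    gcongr
    exact hF s ⟨hs.1.le, hs.2⟩
  have h2 : ‖(2 * Real.pi * Complex.I : ℂ)⁻¹‖ ≤ 1 := by
    rw [norm_inv, norm_mul, norm_mul, Complex.norm_I, Complex.norm_real,
      Real.norm_of_nonneg Real.pi_pos.le, Complex.norm_two, mul_one]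
    exact inv_le_one_of_one_le₀ (by linarith [Real.pi_gt_three])
  rw [contourIntegral, norm_smul]
  exact (mul_le_of_le_one_left (norm_nonneg _) h2).trans h1

/-- Bounded linear maps on operators commute with contour integrals. -/
theorem IsClosedContour.map_contourIntegral (hc : IsClosedContour c)
    (hF : ContinuousOn F (Set.Icc 0 1)) (Λ : (L2 →L[ℂ] L2) →L[ℂ] (L2 →L[ℂ] L2)) :
    Λ (contourIntegral c F) = contourIntegral c fun t => Λ (F t) := by
  rw [contourIntegral, map_smul, ← Λ.intervalIntegral_comp_comm (hc.intervalIntegrable hF)]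
  simp_rw [map_smul]
  rfl

theorem IsClosedContour.comp_contourIntegral (hc : IsClosedContour c)
    (hF : ContinuousOn F (Set.Icc 0 1)) (A : L2 →L[ℂ] L2) :
    A ∘L contourIntegral c F = contourIntegral c fun t => A ∘L F t :=
  hc.map_contourIntegral hF (ContinuousLinearMap.compL ℂ L2 L2 L2 A)

theorem IsClosedContour.contourIntegral_comp (hc : IsClosedContour c)
    (hF : ContinuousOn F (Set.Icc 0 1)) (A : L2 →L[ℂ] L2) :
    contourIntegral c F ∘L A = contourIntegral c fun t => F t ∘L A :=
  hc.map_contourIntegral hF ((ContinuousLinearMap.compL ℂ L2 L2 L2).flip A)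

theorem IsClosedContour.smul_contourIntegral (hc : IsClosedContour c)
    (hF : ContinuousOn F (Set.Icc 0 1)) (z : ℂ) :
    z • contourIntegral c F = contourIntegral c fun t => z • F t :=
  hc.map_contourIntegral hF (z • ContinuousLinearMap.id ℂ _)

theorem IsClosedContour.contourIntegral_add (hc : IsClosedContour c)
    (hF : ContinuousOn F (Set.Icc 0 1)) (hF' : ContinuousOn F' (Set.Icc 0 1)) :
    contourIntegral c F + contourIntegral c F' = contourIntegral c fun t => F t + F' t := by
  rw [contourIntegral, contourIntegral, ← smul_add, ← intervalIntegral.integral_add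
    (hc.intervalIntegrable hF) (hc.intervalIntegrable hF')]
  simp_rw [← smul_add]
  rfl

theorem IsClosedContour.contourIntegral_apply (hc : IsClosedContour c)
    (hF : ContinuousOn F (Set.Icc 0 1)) (f : L2) :
    contourIntegral c F f =
      (2 * Real.pi * Complex.I : ℂ)⁻¹ • ∫ t in (0 : ℝ)..1, deriv c t • F t f := by
  rw [contourIntegral, smul_apply, ContinuousLinearMap.intervalIntegral_apply
    (hc.intervalIntegrable hF)]
  rfl

/-- The position operator is closed: its graph is described by the bounded multiplication operator
`(X + i)⁻¹`. -/
theorem exists_mem_position_graph_iff :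
    ∃ Θ : L2 →L[ℂ] L2, ∀ f g, (f, g) ∈ position.graph ↔ f = Θ (g + Complex.I • f) := by
  have hne : ∀ x : Plane, (x 0 : ℂ) + Complex.I ≠ 0 := fun x h => by
    simpa using congrArg Complex.im h
  obtain ⟨Θ, hΘ⟩ := exists_mulOperator (m := fun x : Plane => ((x 0 : ℂ) + Complex.I)⁻¹)
    (by fun_prop) (C := 1) fun x => by
      rw [norm_inv]
      refine inv_le_one_of_one_le₀ ?_
      simpa using Complex.abs_im_le_norm ((x 0 : ℂ) + Complex.I)
  refine ⟨Θ, fun f g => ?_⟩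
  have h := (hΘ (g + Complex.I • f)).and
    ((Lp.coeFn_add g (Complex.I • f)).and (Lp.coeFn_smul Complex.I f))
  rw [mem_position_graph_iff]
  refine ⟨fun hfg => Lp.ext ?_, fun hfg => ?_⟩
  · filter_upwards [h, hfg] with x h1 h2
    rw [h1.1, h1.2.1, Pi.add_apply, h1.2.2, Pi.smul_apply, h2, smul_eq_mul, ← add_mul,
      inv_mul_cancel_left₀ (hne x)]
  · filter_upwards [h] with x h1
    rw [← hfg] at h1
    have h2 := h1.1
    rw [h1.2.1, Pi.add_apply, h1.2.2, Pi.smul_apply, smul_eq_mul, eq_inv_mul_iff_mul_eq₀ (hne x)]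
      at h2
    linear_combination -h2

theorem IsClosedContour.contourIntegral_mem_graph (hc : IsClosedContour c)
    (hF : ContinuousOn F (Set.Icc 0 1)) (hF' : ContinuousOn F' (Set.Icc 0 1))
    (h : ∀ t ∈ Set.Icc (0 : ℝ) 1, ∀ f, (F t f, F' t f) ∈ position.graph) (f : L2) :
    (contourIntegral c F f, contourIntegral c F' f) ∈ position.graph := by
  obtain ⟨Θ, hΘ⟩ := exists_mem_position_graph_iff
  simp_rw [hΘ] at h ⊢
  have key : contourIntegral c F =
      Θ ∘L (contourIntegral c F' + Complex.I • contourIntegral c F) := by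
    have hIF : ContinuousOn (fun t => Complex.I • F t) (Set.Icc 0 1) :=
      (continuous_const_smul Complex.I).comp_continuousOn hF
    rw [hc.smul_contourIntegral hF, hc.contourIntegral_add hF' hIF,
      hc.comp_contourIntegral (F := fun t => F' t + Complex.I • F t) (hF'.add hIF)]
    exact contourIntegral_congr fun t ht => ContinuousLinearMap.ext fun f => h t ht f
  exact congrArg (fun T : L2 →L[ℂ] L2 => T f) key

end ContourIntegral

/-! ### Tilted band projectors -/

theorem continuousOn_of_norm_sub_le_mul {E : Type*} [NormedAddCommGroup E] {c : ℝ → ℂ} {F : ℝ → E}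
    {S : Set ℝ} {K : ℝ} (hc : ContinuousOn c S)
    (h : ∀ t ∈ S, ∀ s ∈ S, ‖F t - F s‖ ≤ K * ‖c t - c s‖) : ContinuousOn F S := fun s hs => by
  refine tendsto_iff_norm_sub_tendsto_zero.2 ?_
  refine squeeze_zero' (Filter.Eventually.of_forall fun _ => norm_nonneg _)
    (Filter.eventually_of_mem self_mem_nhdsWithin fun t ht => h t ht s hs) ?_
  have := (tendsto_iff_norm_sub_tendsto_zero.1 (hc s hs)).const_mul K
  rwa [mul_zero] at this

theorem continuousOn_opResolvent {T : L2 →ₗ.[ℂ] L2} {c : ℝ → ℂ} (hc : IsClosedContour c) {M : ℝ}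
    (hres : ∀ t ∈ Set.Icc (0 : ℝ) 1, c t ∈ opResolventSet T)
    (hM : ∀ t ∈ Set.Icc (0 : ℝ) 1, ‖opResolvent T (c t)‖ ≤ M) :
    ContinuousOn (fun t => opResolvent T (c t)) (Set.Icc 0 1) := by
  refine continuousOn_of_norm_sub_le_mul (K := M * M) hc.continuousOn fun t ht s hs => ?_
  rw [(opResolvent_spec (hres s hs)).sub_eq (opResolvent_spec (hres t ht)), norm_smul,
    norm_sub_rev, mul_comm]
  gcongr
  refine (ContinuousLinearMap.opNorm_comp_le _ _).trans ?_
  have := (norm_nonneg _).trans (hM s hs)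
  gcongr
  exacts [hM s hs, hM t ht]

theorem comp_rieszIntegral_comp {P : L2 →L[ℂ] L2} (hP : ∀ f, P (P f) = P f) {c : ℝ → ℂ}
    (hc : IsClosedContour c) {M : ℝ}
    (hres : ∀ t ∈ Set.Icc (0 : ℝ) 1, c t ∈ opResolventSet (projectedPosition P))
    (hM : ∀ t ∈ Set.Icc (0 : ℝ) 1, ‖opResolvent (projectedPosition P) (c t)‖ ≤ M) :
    P ∘L rieszIntegral (projectedPosition P) c ∘L P =
      contourIntegral c fun t => opResolvent (projectedPosition P) (c t) ∘L P := by
  have hcont := continuousOn_opResolvent hc hres hM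
  change P ∘L (contourIntegral c fun t => opResolvent (projectedPosition P) (c t)) ∘L P = _
  rw [hc.contourIntegral_comp hcont, hc.comp_contourIntegral (hcont.clm_comp continuousOn_const)]
  exact contourIntegral_congr fun t ht => ContinuousLinearMap.ext fun f =>
    ((opResolvent_spec (hres t ht)).isCompressedResolvent hP).range f

/-- The tilt `Q'` of the contour integral of the compressed resolvents of `PXP`, with bounds on
`(X - η) Q'` and on `Q' (X - η)` in terms of the distance of `η` to the contour. -/
theorem exists_tilt_contourIntegral {P A P' A' W : L2 →L[ℂ] L2} {c : ℝ → ℂ} {r : ℝ → L2 →L[ℂ] L2}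
    (hc : IsClosedContour c)
    (hr : ∀ t ∈ Set.Icc (0 : ℝ) 1, IsCompressedResolvent position.graph P (c t) (r t))
    (hP : ∀ f, P (P f) = P f) (hA : IsCommutator position.graph P A)
    (hA' : IsCommutator position.graph P' A') {γ : ℝ} {a : Plane} (hW : IsInvWeight γ a W)
    (hPW : ∀ f, P (W f) = W (P' f)) {M p α L : ℝ} (hp : 1 ≤ p)
    (hM : ∀ t ∈ Set.Icc (0 : ℝ) 1, ‖r t‖ ≤ M) (hp' : ‖P'‖ ≤ p) (hα : ‖A‖ ≤ α) (hα' : ‖A'‖ ≤ α)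
    (hsmall : ‖P' - P‖ * (p ^ 2 * (1 + 2 * α * M)) ≤ 1 / 2) (hL : contourLength c ≤ L) :
    ∃ Q' V V' : L2 →L[ℂ] L2, (∀ f, contourIntegral c r (W f) = W (Q' f)) ∧
      ‖Q'‖ ≤ 2 * p ^ 2 * M * L ∧ (∀ f, (Q' f, V f) ∈ position.graph) ∧
      (∀ f g, (f, g) ∈ position.graph → Q' g = V' f) ∧
      ∀ (η : ℂ) (B : ℝ), (∀ t ∈ Set.Icc (0 : ℝ) 1, ‖c t - η‖ ≤ B) →
        ‖V - η • Q'‖ ≤ ((B + α) * (2 * p ^ 2 * M) + p) * L ∧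
        ‖V' - η • Q'‖ ≤ ((B + α) * (2 * p ^ 2 * M) + p) * L := by
  have h0 : (0 : ℝ) ∈ Set.Icc (0 : ℝ) 1 := ⟨le_rfl, zero_le_one⟩
  have hM0 : 0 ≤ M := (norm_nonneg _).trans (hM 0 h0)
  have hα0 : 0 ≤ α := (norm_nonneg _).trans hα
  choose! s hs hWs hsn using fun t (ht : t ∈ Set.Icc (0 : ℝ) 1) =>
    (hr t ht).exists_tilt position_graph_functional hP hA hA' hW.injective hW.position_graph hPW hp
      (hM t ht) hp' hα hα' hsmall
  set N := 2 * p ^ 2 * M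
  have hN0 : 0 ≤ N := by positivity
  have hP' : ∀ f, P' (P' f) = P' f := fun f => hW.injective (by rw [← hPW, ← hPW, hP, hPW])
  have hrc : ContinuousOn r (Set.Icc 0 1) := continuousOn_of_norm_sub_le_mul hc.continuousOn
    fun t ht t' ht' => (hr t' ht').norm_sub_le_sq_mul (hr t ht) (hM t' ht') (hM t ht)
  have hsc : ContinuousOn s (Set.Icc 0 1) := continuousOn_of_norm_sub_le_mul hc.continuousOn
    fun t ht t' ht' => (hs t' ht').norm_sub_le_sq_mul (hs t ht) (hsn t' ht') (hsn t ht)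
  have hzs : ContinuousOn (fun t => c t • s t) (Set.Icc 0 1) := hc.continuousOn.smul hsc
  let v : ℝ → L2 →L[ℂ] L2 := fun t => c t • s t + A' ∘L s t - P'
  let v' : ℝ → L2 →L[ℂ] L2 := fun t => c t • s t - P' - s t ∘L A'
  have hv : ContinuousOn v (Set.Icc 0 1) :=
    (hzs.add (continuousOn_const.clm_comp hsc)).sub continuousOn_const
  have hv' : ContinuousOn v' (Set.Icc 0 1) :=
    (hzs.sub continuousOn_const).sub (hsc.clm_comp continuousOn_const)
  refine ⟨contourIntegral c s, contourIntegral c v, contourIntegral c v', fun f => ?_, ?_,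
    hc.contourIntegral_mem_graph hsc hv fun t ht f => ?_, fun f g hfg => ?_, fun η B hB => ?_⟩
  · have : contourIntegral c r ∘L W = W ∘L contourIntegral c s := by
      rw [hc.contourIntegral_comp hrc, hc.comp_contourIntegral hsc]
      exact contourIntegral_congr fun t ht => ContinuousLinearMap.ext fun f => (hWs t ht f).symm
    exact congrArg (fun T : L2 →L[ℂ] L2 => T f) this
  · exact (hc.norm_contourIntegral_le hsn).trans (by gcongr)
  · exact (hs t ht).graph_mem hA' f
  · rw [hc.contourIntegral_apply hsc, hc.contourIntegral_apply hv',
      intervalIntegral.integral_congr fun t ht => ?_]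
    rw [Set.uIcc_of_le zero_le_one] at ht
    simp only [(hs t ht).apply_of_mem hP' hA' hfg]
    rfl
  · have hB0 : 0 ≤ B := (norm_nonneg _).trans (hB 0 h0)
    have hηs : ContinuousOn (fun t => (-η) • s t) (Set.Icc 0 1) :=
      (continuous_const_smul (-η)).comp_continuousOn hsc
    have hbound : ∀ t ∈ Set.Icc (0 : ℝ) 1, ∀ E : L2 →L[ℂ] L2, ‖E‖ ≤ α * N →
        ‖(c t - η) • s t + E - P'‖ ≤ (B + α) * N + p := fun t ht E hE => by
      refine (norm_sub_le_of_le (norm_add_le_of_le (?_ : _ ≤ B * N) hE) hp').trans_eq (by ring)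
      rw [norm_smul]
      gcongr
      exacts [hB t ht, hsn t ht]
    constructor
    · rw [sub_eq_add_neg, ← neg_smul, hc.smul_contourIntegral hsc, hc.contourIntegral_add hv hηs]
      refine (hc.norm_contourIntegral_le (M := (B + α) * N + p) fun t ht => ?_).trans (by gcongr)
      rw [show v t + -η • s t = (c t - η) • s t + A' ∘L s t - P' by
        simp only [v, sub_smul, neg_smul]; abel]
      refine hbound t ht _ ((ContinuousLinearMap.opNorm_comp_le _ _).trans ?_)
      gcongr
      exact hsn t ht
    · rw [sub_eq_add_neg, ← neg_smul, hc.smul_contourIntegral hsc, hc.contourIntegral_add hv' hηs]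
      refine (hc.norm_contourIntegral_le (M := (B + α) * N + p) fun t ht => ?_).trans (by gcongr)
      rw [show v' t + -η • s t = (c t - η) • s t + -(s t ∘L A') - P' by
        simp only [v', sub_smul, neg_smul]; abel]
      refine hbound t ht _ ?_
      rw [norm_neg, mul_comm]
      refine (ContinuousLinearMap.opNorm_comp_le _ _).trans ?_
      gcongr
      exact hsn t ht

theorem IsInvWeight.mem_tilt_graph_iff {γ : ℝ} {a : Plane} {W Q Q' : L2 →L[ℂ] L2}
    (hW : IsInvWeight γ a W) (hQ : ∀ f, Q (W f) = W (Q' f)) {f h : L2} :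
    (f, h) ∈ (tilt γ a Q).graph ↔ Q' f = h := by
  have hne : ∀ x, ((expWeight γ a x : ℝ) : ℂ) ≠ 0 := fun x =>
    Complex.ofReal_ne_zero.2 (expWeight_pos γ a x).ne'
  have h1 : ∀ g, (f, g) ∈ (mulOp fun x => (expWeight γ a x)⁻¹).graph ↔ W f = g := fun g => by
    have hg : (f, W f) ∈ (mulOp fun x => (expWeight γ a x)⁻¹).graph := by
      rw [mem_mulOp_graph_iff]
      filter_upwards [hW f] with x hx
      rw [hx, Complex.ofReal_inv]
    exact ⟨fun h' => LinearPMap.mem_graph_snd_inj _ hg h' rfl, fun h' => h' ▸ hg⟩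
  have h2 : ∀ g, (W g, h) ∈ (mulOp (expWeight γ a)).graph ↔ g = h := fun g => by
    have hg : (W g, g) ∈ (mulOp (expWeight γ a)).graph := by
      rw [mem_mulOp_graph_iff]
      filter_upwards [hW g] with x hx
      rw [hx, mul_inv_cancel_left₀ (hne x)]
    exact ⟨fun h' => LinearPMap.mem_graph_snd_inj _ hg h' rfl, fun h' => h' ▸ hg⟩
  simp only [tilt, mem_opComp_graph_iff, mem_ofBounded_graph_iff, h1]
  simp only [exists_eq_left', hQ, h2]

end BandProjectors

theorem proposition4p2 (P : L2 →L[ℂ] L2) (hP : IsExpLocalizedProjector P)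
    {J : Type*} [Countable J] (σ : J → Set ℝ) (d D : ℝ)
    (hσ : UniformSpectralGaps (projectedPosition P) σ d D) (K K' : ℝ) :
    ∃ C C' γ : ℝ, 0 < C ∧ 0 < C' ∧ 0 < γ ∧
      ∀ (j : J) (Pj : L2 →L[ℂ] L2), IsBandProjector P σ d D K K' j Pj →
        HasExpBoundedKernel Pj C γ ∧
        ∀ η ∈ σ j, ∀ γ' ∈ Set.Icc 0 γ, ∀ a : Plane,
          IsBoundedBy (opComp (positionSub η) (tilt γ' a Pj)) C' ∧
          IsBoundedOnPositionDomainBy (opComp (tilt γ' a Pj) (positionSub η)) C' := by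
  obtain ⟨⟨hidem, hself⟩, C₀, γ₀, hC₀, hγ₀, hker⟩ := hP
  have hd := hσ.gap_pos
  obtain ⟨k, hk, hkP⟩ := hker.exists_isExpKernel hC₀.le
  have hPP : ∀ f, P (P f) = P f := fun f => congrArg (fun T : L2 →L[ℂ] L2 => T f) hidem
  have hsa : ∀ f g, ⟪P f, g⟫_ℂ = ⟪f, P g⟫_ℂ := fun f g => by
    rw [← ContinuousLinearMap.adjoint_inner_right, ← ContinuousLinearMap.star_eq_adjoint,
      hself.star_eq]
  obtain ⟨A, hA, -⟩ := hk.exists_isCommutator hγ₀ hC₀.le hkP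
  -- bounds on the compressed resolvents, contour lengths, tilted projectors, commutators
  set M := |K * d⁻¹| * ‖P‖
  set L := |K' * (D + d)| + 1
  set p := max 1 (C₀ * expMass (γ₀ / 2))
  set α₀ := C₀ * (4 / γ₀) * expMass (γ₀ / 4)
  set α := max ‖A‖ α₀
  have hM : 0 ≤ M := by positivity
  have hL : 0 < L := by positivity
  have hp : 1 ≤ p := le_max_left _ _
  have hα : 0 ≤ α := (norm_nonneg A).trans (le_max_left _ _)
  set κ := p ^ 2 * (1 + 2 * α * M)
  have hκ : 0 ≤ κ := by positivity
  set γ := min (γ₀ / 2) (1 / (2 * (α * κ + 1)))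
  have hγ : 0 < γ := lt_min (by positivity) (by positivity)
  have hγle : γ ≤ γ₀ / 2 := min_le_left _ _
  set N := 2 * p ^ 2 * M
  have hN : 0 ≤ N := by positivity
  refine ⟨C₀ ^ 2 * Real.exp γ * expMass γ₀ * (N * L) + 1, ((2 * L + α) * N + p) * L, γ,
    by have := expMass_nonneg γ₀; positivity, by positivity, hγ, ?_⟩
  rintro j Pj ⟨c, hc, rfl⟩
  have hcL : contourLength c ≤ L := by
    linarith [hc.length_le, le_abs_self (K' * (D + d))]
  have hRM : ∀ t ∈ Set.Icc (0 : ℝ) 1, ‖opResolvent (projectedPosition P) (c t)‖ ≤ |K * d⁻¹| :=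
    fun t ht => (hc.norm_resolvent_le t ht).trans (le_abs_self _)
  have hr := fun t ht => (opResolvent_spec (hc.mem_resolventSet t ht)).isCompressedResolvent hPP
  have hQ := comp_rieszIntegral_comp hPP hc.contour hc.mem_resolventSet hRM
  set Pj := P ∘L rieszIntegral (projectedPosition P) c ∘L P with hPj
  have tilted : ∀ γ' ∈ Set.Icc 0 γ, ∀ a, ∃ W Q' V V' : L2 →L[ℂ] L2, IsInvWeight γ' a W ∧
      (∀ f, Pj (W f) = W (Q' f)) ∧ ‖Q'‖ ≤ N * L ∧ (∀ f, (Q' f, V f) ∈ position.graph) ∧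
      (∀ f g, (f, g) ∈ position.graph → Q' g = V' f) ∧
      ∀ (η : ℂ) (B : ℝ), (∀ t ∈ Set.Icc (0 : ℝ) 1, ‖c t - η‖ ≤ B) →
        ‖V - η • Q'‖ ≤ ((B + α) * N + p) * L ∧ ‖V' - η • Q'‖ ≤ ((B + α) * N + p) * L := by
    intro γ' hγ' a
    obtain ⟨W, hW⟩ := exists_isInvWeight hγ'.1 a
    obtain ⟨P', A', hPW, hA', hPn, hAn, hPd⟩ := hk.exists_tilt hγ₀ hC₀.le hkP hγ'.1
      (hγ'.2.trans hγle) hW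
    have hsmall : ‖P' - P‖ * κ ≤ 1 / 2 := by
      have h1 : γ' * (2 * (α * κ + 1)) ≤ 1 := by
        rw [← le_div_iff₀ (by positivity)]
        exact hγ'.2.trans (min_le_right _ _)
      calc ‖P' - P‖ * κ ≤ γ' * α * κ := by
            gcongr
            exact hPd.trans (mul_le_mul_of_nonneg_left (le_max_right _ _) hγ'.1)
        _ ≤ 1 / 2 := by nlinarith [hγ'.1]
    obtain ⟨Q', V, V', h⟩ := exists_tilt_contourIntegral hc.contour hr hPP hA hA' hW hPW hp
      (fun t ht => (ContinuousLinearMap.opNorm_comp_le _ _).trans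
        (mul_le_mul_of_nonneg_right (hRM t ht) (norm_nonneg P)))
      (hPn.trans (le_max_right _ _)) (le_max_left _ _) (hAn.trans (le_max_right _ _)) hsmall hcL
    rw [← hQ] at h
    exact ⟨W, Q', V, V', hW, h⟩
  constructor
  · obtain ⟨l, hl, hlb⟩ := hk.hasExpBoundedKernel (Q := Pj) (M := N * L) hγ₀ hC₀.le hkP hsa
      (fun f => hPP _) (fun f => by simp only [hPj, ContinuousLinearMap.comp_apply, hPP]) hγ.le
      hγle (by positivity) fun a => by
        obtain ⟨W, Q', V, V', hW, h1, h2, -⟩ := tilted γ ⟨hγ.le, le_rfl⟩ a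
        exact ⟨W, Q', hW, h1, h2⟩
    refine ⟨l, hl, hlb.mono fun q hq => hq.trans ?_⟩
    gcongr
    linarith
  · intro η hη γ' hγ' a
    obtain ⟨W, Q', V, V', hW, hWQ, -, hV, hV', hB⟩ := tilted γ' hγ' a
    obtain ⟨hb, hb'⟩ := hB (η : ℂ) (2 * L) fun t ht =>
      hc.contour.norm_sub_le_of_windingNumber hL hcL (hc.winding_self η hη) ht
    constructor
    · refine isBoundedBy_of_graph fun f => ⟨(V - (η : ℂ) • Q') f, ?_,
        ContinuousLinearMap.le_of_opNorm_le _ hb f⟩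
      rw [mem_opComp_graph_iff]
      refine ⟨Q' f, (hW.mem_tilt_graph_iff hWQ).2 rfl, mem_positionSub_graph_iff.2 ?_⟩
      rw [sub_apply, smul_apply, sub_add_cancel]
      exact hV f
    · refine isBoundedOnPositionDomainBy_of_graph (fun f g hfg => ?_) fun f h hfh => ?_
      · refine ⟨Q' (g - (η : ℂ) • f), mem_opComp_graph_iff.2 ⟨g - (η : ℂ) • f, ?_,
          (hW.mem_tilt_graph_iff hWQ).2 rfl⟩⟩
        rw [mem_positionSub_graph_iff, sub_add_cancel]
        exact hfg
      · obtain ⟨g, hfg, hgh⟩ := mem_opComp_graph_iff.1 hfh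
        rw [mem_positionSub_graph_iff] at hfg
        rw [hW.mem_tilt_graph_iff hWQ] at hgh
        have := hV' _ _ hfg
        rw [map_add, map_smul, hgh] at this
        rw [eq_sub_of_add_eq this]
        exact ContinuousLinearMap.le_of_opNorm_le _ hb' f
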